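/- For partitions $\mu,\nu$ let $s_\mu=\sum_T x^T$ (sum over semistandard Young tableaux $T$ of shape $\mu$) be the Schur function in countably many variables. Each product $s_\mu s_\nu$ has a unique expansion $s_\mu s_\nu=\sum_\lambda c^\lambda_{\mu\nu}s_\lambda$ as a finite integer linear combination of Schur functions; its coefficients $c^\lambda_{\mu\nu}$ are the Littlewood–Richardson coefficients. For a finite-dimensional complex representation $\mathfrak g$ of a group $K$, let $\mathcal S^d(\mathfrak g)$ be the degree-$d$ part of the symmetric algebra, on which $K$ acts by algebra automorphisms, and let $H(\mathfrak g,K;t)=\sum_{d\ge0}\dim\big[\mathcal S^d(\mathfrak g)\big]^K\,t^d$. Limits of formal power series are taken coefficient by coefficient. **Theorem.** As formal power series, with the sum over all triples of partitions $(\lambda,\mu,\nu)$, $$\sum_{\lambda,\mu,\nu}\big(c^\lambda_{\mu\nu}\big)^2\,t^{|\lambda|}=\prod_{k=1}^\infty\frac1{1-2t^k},$$ where both the infinite sum and the infinite product converge. Moreover this series is the stable Hilbert series $$\lim_{\min(p,q)\to\infty}H\big(\mathfrak{gl}_{p+q}(\mathbb C),\,GL_p(\mathbb C)\times GL_q(\mathbb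 C);t\big)=\lim_{n\to\infty}H\big(\mathfrak{gl}_n(\mathbb C)\oplus\mathfrak{gl}_n(\mathbb C),\,GL_n(\mathbb C);t\big)=\prod_{k=1}^\infty\frac1{1-2t^k}.$$ Here $GL_p(\mathbb C)\times GL_q(\mathbb C)$ is embedded block-diagonally in $GL_{p+q}(\mathbb C)$, which acts on $\mathfrak{gl}_{p+q}(\mathbb C)$ by conjugation, and $GL_n(\mathbb C)$ acts on $\mathfrak{gl}_n(\mathbb C)\oplus\mathfrak{gl}_n(\mathbb C)$ by simultaneous conjugation. -/

import Mathlib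

open Filter Topology
open scoped PowerSeries.WithPiTopology

noncomputable section

/-- The number of entries equal to `i` in a semistandard tableau of shape `μ`, as a function
of `i` (its content, or weight). -/
def ssytContent {μ : YoungDiagram} (T : SemistandardYoungTableau μ) : ℕ →₀ ℕ :=
  ∑ c ∈ μ.cells, Finsupp.single (T c.1 c.2) 1

/-- The Schur function `s_μ` in the countably many variables `x₀, x₁, x₂, …`: the generating
function `∑_T x^T` over all semistandard Young tableaux `T` of shape `μ`. -/
def schurFunction (μ : YoungDiagram) : MvPowerSeries ℕ ℤ :=
  fun m => (Nat.card {T : SemistandardYoungTableau μ // ssytContent T = m} : ℤ)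

/-- `f` is a (finitely supported) family of coefficients with `s_μ s_ν = ∑_lam f(lam) s_lam`. -/
def IsSchurExpansion (μ ν : YoungDiagram) (f : YoungDiagram →₀ ℤ) : Prop :=
  schurFunction μ * schurFunction ν = f.sum fun lam a => a • schurFunction lam

/-- The Littlewood-Richardson coefficient `c^lam_{μν}`: the coefficient of `s_lam` in the
expansion of `s_μ s_ν` in Schur functions. The existence and the uniqueness of that expansion
are asserted wherever these coefficients are used in a statement. -/
def lrCoeff (lam μ ν : YoungDiagram) : ℤ :=
  Classical.epsilon (IsSchurExpansion μ ν) lam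

/-- The adjoint representation of `GL_ι(ℂ)` on its Lie algebra: `g` acts by `X ↦ g X g⁻¹`. -/
def adjointRep (ι : Type) [Fintype ι] [DecidableEq ι] :
    Representation ℂ (GL ι ℂ) (Matrix ι ι ℂ) where
  toFun g :=
    { toFun := fun X => (g : Matrix ι ι ℂ) * X * ((g⁻¹ : GL ι ℂ) : Matrix ι ι ℂ)
      map_add' := fun X Y => by rw [mul_add, add_mul]
      map_smul' := fun c X => by simp }
  map_one' := by ext1 X; simp
  map_mul' g h := by ext1 X; simp [mul_assoc]

/-- The block diagonal embedding `GL_p(ℂ) × GL_q(ℂ) → GL_{p+q}(ℂ)`. -/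
def blockDiagonalHom (p q : ℕ) :
    GL (Fin p) ℂ × GL (Fin q) ℂ →* GL (Fin p ⊕ Fin q) ℂ where
  toFun k :=
    { val := Matrix.fromBlocks k.1 0 0 k.2
      inv := Matrix.fromBlocks (k.1⁻¹ : GL (Fin p) ℂ) 0 0 (k.2⁻¹ : GL (Fin q) ℂ)
      val_inv := by
        rw [Matrix.fromBlocks_multiply]
        simp only [← Units.val_mul]
        simp
      inv_val := by
        rw [Matrix.fromBlocks_multiply]
        simp only [← Units.val_mul]
        simp }
  map_one' := by ext1; simp
  map_mul' k l := by ext1; simp [Matrix.fromBlocks_multiply]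

/-- The action of `K = GL_p(ℂ) × GL_q(ℂ)` on `𝔤𝔩_{p+q}(ℂ)`, restricted from the adjoint
representation of `GL_{p+q}(ℂ)`. -/
def upqRep (p q : ℕ) :
    Representation ℂ (GL (Fin p) ℂ × GL (Fin q) ℂ)
      (Matrix (Fin p ⊕ Fin q) (Fin p ⊕ Fin q) ℂ) :=
  (adjointRep (Fin p ⊕ Fin q)).comp (blockDiagonalHom p q)

/-- The action of the diagonal subgroup `K = GL_n(ℂ)` of `GL_n(ℂ) × GL_n(ℂ)` on
`𝔤𝔩_n(ℂ) ⊕ 𝔤𝔩_n(ℂ)`, restricted from the adjoint representation. -/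
def glnRep (n : ℕ) :
    Representation ℂ (GL (Fin n) ℂ)
      (Matrix (Fin n) (Fin n) ℂ × Matrix (Fin n) (Fin n) ℂ) :=
  (adjointRep (Fin n)).prod (adjointRep (Fin n))

/-- The algebra endomorphism of the symmetric algebra `S(V)` induced by an endomorphism of `V`. -/
def symMap {V : Type} [AddCommGroup V] [Module ℂ V] (φ : V →ₗ[ℂ] V) :
    SymmetricAlgebra ℂ V →ₐ[ℂ] SymmetricAlgebra ℂ V :=
  SymmetricAlgebra.lift (SymmetricAlgebra.ι ℂ V ∘ₗ φ)

/-- The space `[S^d(V)]^K` of `K`-invariants in the degree `d` part of the symmetric algebra of a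
representation `V` of `K`, where `K` acts by algebra automorphisms extending the action on `V`. -/
def symInvariants {K V : Type} [Group K] [AddCommGroup V] [Module ℂ V]
    (ρ : Representation ℂ K V) (d : ℕ) : Submodule ℂ (SymmetricAlgebra ℂ V) :=
  (LinearMap.range (SymmetricAlgebra.ι ℂ V)) ^ d ⊓
    ⨅ k : K, LinearMap.eqLocus (symMap (ρ k)).toLinearMap LinearMap.id

/-- The Hilbert series `∑_d dim [S^d(V)]^K t^d`. -/
def hilbertSeries {K V : Type} [Group K] [AddCommGroup V] [Module ℂ V]
    (ρ : Representation ℂ K V) : PowerSeries ℚ :=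
  PowerSeries.mk fun d => (Module.finrank ℂ (symInvariants ρ d) : ℚ)

/-- The formal power series `∏_{k ≥ 1} 1 / (1 - 2 t^k)`; the product is indexed by `k - 1`. -/
def stableProduct : PowerSeries ℚ :=
  ∏' k : ℕ, (1 - 2 * (PowerSeries.X : PowerSeries ℚ) ^ (k + 1))⁻¹

end

/-! Everything reduces to one number: the coefficient of $t^d$ in the product is the sum of
$2^{\ell(p)}$ over the partitions $p$ of $d$, with $\ell(p)$ the number of parts, because each part
carries a factor 2 (`coeff_stableProduct`).

Littlewood–Richardson side (`sum_sq_lrCoeff`). Comultiplication followed by multiplication is an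
operator on symmetric functions of degree $n$. In the Schur basis its $(\lambda,\kappa)$ entry is
$\sum_{\mu,\nu} c^\lambda_{\mu\nu}c^\kappa_{\mu\nu}$, so its trace is the sum of squares. It sends
$h_\alpha$ to $\sum_{\beta+\gamma=\alpha}h_\beta h_\gamma$, and the diagonal entry in this basis
counts the ways to deal the parts of $\alpha$ into two piles, $2^{\ell(\alpha)}$. The two bases are
related by the unitriangular Kostka matrix. The expansion $h_\alpha=\sum_\lambda
K_{\lambda\alpha}s_\lambda$ rests on Pieri's rule, which is proved coefficient by coefficient,
without using that Schur functions are symmetric, from a bijection between common horizontal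
substrips and superstrips of two diagrams (`card_common_strips`).

Invariant side (`finrank_symInvariants_eq_card_orbits`). An invariant of degree $d$ is a symmetric
tensor whose slices commute with $X^{\otimes d}$ for all block diagonal $X$. If every block has size
at least $d$, such tensors correspond uniquely to weights on permutations of $d$ strands, each
strand labelled by a copy of the matrix space and a block (`eq_strandTensor_of_commute`,
`strandTensor_injective`). Symmetry makes the weights constant on conjugacy orbits. Both families of
groups have exactly two labels, two blocks or two copies, and Burnside's lemma counts $\sum_p
2^{\ell(p)}$ orbits (`card_orbits_labelledPerm`). -/

namespace YoungDiagram

/-! ### Young diagrams and horizontal strips -/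

theorem ext_rowLen {μ ν : YoungDiagram} (h : ∀ i, μ.rowLen i = ν.rowLen i) : μ = ν := by
  ext ⟨i, j⟩
  rw [mem_cells, mem_cells, mem_iff_lt_rowLen, mem_iff_lt_rowLen, h]

/-- The Young diagram whose row lengths are given by an antitone function that vanishes at `N`. -/
def ofAntitone (f : ℕ → ℕ) (hf : Antitone f) (N : ℕ) (_hN : f N = 0) : YoungDiagram where
  cells := (Finset.range N ×ˢ Finset.range (f 0)).filter fun c => c.2 < f c.1
  isLowerSet := by
    rintro ⟨i, j⟩ ⟨i', j'⟩ ⟨h1, h2⟩ h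
    simp only [Finset.coe_filter, Finset.mem_product, Finset.mem_range, Set.mem_ofPred_eq] at h ⊢
    have := hf h1
    have := hf (Nat.zero_le i')
    dsimp only at *
    omega

theorem rowLen_ofAntitone (f : ℕ → ℕ) (hf : Antitone f) (N : ℕ) (hN : f N = 0) (i : ℕ) :
    (ofAntitone f hf N hN).rowLen i = f i := by
  have key : ∀ j, j < (ofAntitone f hf N hN).rowLen i ↔ j < f i := by
    intro j
    rw [← mem_iff_lt_rowLen, ← mem_cells]
    simp only [ofAntitone, Finset.mem_filter, Finset.mem_product, Finset.mem_range]
    have := hf (Nat.zero_le i)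
    refine ⟨fun h => h.2, fun h => ⟨⟨?_, by omega⟩, h⟩⟩
    by_contra! h'
    have := hf h'
    omega
  exact le_antisymm (not_lt.1 fun h => (lt_irrefl _ ((key _).1 h)))
    (not_lt.1 fun h => (lt_irrefl _ ((key _).2 h)))

theorem rowLen_eq_zero_of_colLen_le {μ : YoungDiagram} {i : ℕ} (h : μ.colLen 0 ≤ i) :
    μ.rowLen i = 0 := by
  by_contra h'
  have : (i, 0) ∈ μ := mem_iff_lt_rowLen.2 (Nat.pos_of_ne_zero h')
  rw [mem_iff_lt_colLen] at this
  omega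

theorem sum_cells {M : Type*} [AddCommMonoid M] (μ : YoungDiagram) {N : ℕ}
    (hN : μ.rowLen N = 0) (f : ℕ → ℕ → M) :
    ∑ c ∈ μ.cells, f c.1 c.2 = ∑ i ∈ Finset.range N, ∑ j ∈ Finset.range (μ.rowLen i), f i j := by
  rw [Finset.sum_sigma']
  refine Finset.sum_bij' (fun c _ => ⟨c.1, c.2⟩) (fun c _ => (c.1, c.2)) ?_ ?_ ?_ ?_ ?_
  · rintro ⟨i, j⟩ h
    rw [mem_cells, mem_iff_lt_rowLen] at h
    simp only [Finset.mem_sigma, Finset.mem_range]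
    refine ⟨?_, h⟩
    by_contra! h'
    have := μ.rowLen_anti _ _ h'
    omega
  · rintro ⟨i, j⟩ h
    simp only [Finset.mem_sigma, Finset.mem_range] at h
    rw [mem_cells, mem_iff_lt_rowLen]
    exact h.2
  all_goals intros; rfl

theorem card_eq_sum_rowLen (μ : YoungDiagram) {N : ℕ} (hN : μ.rowLen N = 0) :
    μ.card = ∑ i ∈ Finset.range N, μ.rowLen i := by
  have := sum_cells μ hN fun _ _ => 1
  simpa using this

theorem finite_card_eq (n : ℕ) : {μ : YoungDiagram | μ.card = n}.Finite := by
  refine Set.Finite.of_finite_image (f := cells)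
    ((Finset.finite_toSet (Finset.range n ×ˢ Finset.range n).powerset).subset ?_) ?_
  · rintro _ ⟨μ, hμ, rfl⟩
    simp only [Finset.coe_powerset, Set.mem_preimage, Set.mem_powerset_iff, Finset.coe_subset]
    rintro ⟨i, j⟩ h
    have hi : (Finset.range (i + 1)).image (fun a => (a, j)) ⊆ μ.cells := by
      intro c hc
      obtain ⟨a, ha, rfl⟩ := Finset.mem_image.1 hc
      exact μ.up_left_mem (Nat.lt_succ_iff.1 (Finset.mem_range.1 ha)) le_rfl h
    have hj : (Finset.range (j + 1)).image (fun a => (i, a)) ⊆ μ.cells := by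
      intro c hc
      obtain ⟨a, ha, rfl⟩ := Finset.mem_image.1 hc
      exact μ.up_left_mem le_rfl (Nat.lt_succ_iff.1 (Finset.mem_range.1 ha)) h
    have h1 := Finset.card_le_card hi
    have h2 := Finset.card_le_card hj
    rw [Finset.card_image_of_injective _ (fun a b h => (Prod.ext_iff.1 h).1),
      Finset.card_range] at h1
    rw [Finset.card_image_of_injective _ (fun a b h => (Prod.ext_iff.1 h).2),
      Finset.card_range] at h2
    have : μ.cells.card = n := hμ
    simp only [Finset.mem_product, Finset.mem_range]
    omega
  · intro μ _ ν _ h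
    exact YoungDiagram.ext h

/-- The finite set of Young diagrams with `n` cells. -/
noncomputable def ofCard (n : ℕ) : Finset YoungDiagram := (finite_card_eq n).toFinset

@[simp] theorem mem_ofCard {n : ℕ} {μ : YoungDiagram} : μ ∈ ofCard n ↔ μ.card = n := by
  simp [ofCard]

/-- `κ ⊆ μ` and the skew shape `μ / κ` is a horizontal strip. -/
def IsHorizontalStrip (κ μ : YoungDiagram) : Prop :=
  ∀ i, κ.rowLen i ≤ μ.rowLen i ∧ μ.rowLen (i + 1) ≤ κ.rowLen i

theorem IsHorizontalStrip.card_le {κ μ : YoungDiagram} (h : IsHorizontalStrip κ μ) :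
    κ.card ≤ μ.card := by
  have hμ := rowLen_eq_zero_of_colLen_le (le_refl (μ.colLen 0))
  have hκ : κ.rowLen (μ.colLen 0) = 0 := by have := (h (μ.colLen 0)).1; omega
  rw [card_eq_sum_rowLen _ hμ, card_eq_sum_rowLen _ hκ]
  exact Finset.sum_le_sum fun i _ => (h i).1

theorem finite_strips (μ : YoungDiagram) : {κ | IsHorizontalStrip κ μ}.Finite := by
  refine ((Finset.range (μ.card + 1)).finite_toSet.biUnion fun n _ => finite_card_eq n).subset ?_
  intro κ hκ
  exact Set.mem_biUnion (Finset.mem_coe.2 (Finset.mem_range.2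
    (Nat.lt_succ_of_le (IsHorizontalStrip.card_le hκ)))) rfl

/-- The diagrams that are obtained from `μ` by removing a horizontal strip. -/
noncomputable def strips (μ : YoungDiagram) : Finset YoungDiagram := (finite_strips μ).toFinset

@[simp] theorem mem_strips {κ μ : YoungDiagram} : κ ∈ strips μ ↔ IsHorizontalStrip κ μ := by
  simp [strips]

/-- The reflection of `κ` that turns common horizontal substrips of `μ` and `ρ` into common
horizontal superstrips, with first row `a`. -/
theorem exists_reflection_up {μ ρ κ : YoungDiagram} (h1 : IsHorizontalStrip κ μ)
    (h2 : IsHorizontalStrip κ ρ) (k : ℕ) :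
    ∃ ν : YoungDiagram, ν.rowLen 0 = max (μ.rowLen 0) (ρ.rowLen 0) + k ∧
      ∀ i, ν.rowLen (i + 1) + κ.rowLen i =
        max (μ.rowLen (i + 1)) (ρ.rowLen (i + 1)) + min (μ.rowLen i) (ρ.rowLen i) := by
  -- The possible values of $\kappa_i$ and of $\nu_{i+1}$ fill the same interval, from
  -- $\max(\mu_{i+1},\rho_{i+1})$ to $\min(\mu_i,\rho_i)$; the witness reflects this interval. Only
  -- $\nu_0$ has no partner, and $k$ is its free excess.
  let f : ℕ → ℕ := fun i => Nat.casesOn i (max (μ.rowLen 0) (ρ.rowLen 0) + k) fun i =>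
    max (μ.rowLen (i + 1)) (ρ.rowLen (i + 1)) + min (μ.rowLen i) (ρ.rowLen i) - κ.rowLen i
  have f0 : f 0 = max (μ.rowLen 0) (ρ.rowLen 0) + k := rfl
  have fs : ∀ i, f (i + 1) = max (μ.rowLen (i + 1)) (ρ.rowLen (i + 1)) +
    min (μ.rowLen i) (ρ.rowLen i) - κ.rowLen i := fun i => rfl
  have hf : Antitone f := by
    refine antitone_nat_of_succ_le fun i => ?_
    cases i with
    | zero =>
      rw [f0, fs]
      have := h1 0; have := h2 0
      simp only [zero_add] at *
      omega
    | succ i =>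
      rw [fs, fs]
      have := h1 i; have := h2 i
      have := h1 (i + 1); have := h2 (i + 1)
      omega
  have hN : f (max (μ.colLen 0) (ρ.colLen 0) + 1) = 0 := by
    rw [fs]
    have a1 := rowLen_eq_zero_of_colLen_le (le_max_left (μ.colLen 0) (ρ.colLen 0))
    have a2 := rowLen_eq_zero_of_colLen_le (le_max_right (μ.colLen 0) (ρ.colLen 0))
    have a3 := μ.rowLen_anti _ _ (Nat.le_add_right (max (μ.colLen 0) (ρ.colLen 0)) 1)
    have a4 := ρ.rowLen_anti _ _ (Nat.le_add_right (max (μ.colLen 0) (ρ.colLen 0)) 1)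
    omega
  refine ⟨ofAntitone f hf (max (μ.colLen 0) (ρ.colLen 0) + 1) hN, ?_, fun i => ?_⟩
  · rw [rowLen_ofAntitone, f0]
  · rw [rowLen_ofAntitone, fs]
    have := h1 i; have := h2 i
    omega

/-- The same reflection, read backwards. The first row of $\nu$ is forgotten, so $\nu$ is recovered
from $\kappa$ together with its excess in row 0. -/
theorem exists_reflection_down {μ ρ ν : YoungDiagram} (h1 : IsHorizontalStrip μ ν)
    (h2 : IsHorizontalStrip ρ ν) :
    ∃ κ : YoungDiagram, ∀ i, ν.rowLen (i + 1) + κ.rowLen i =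
        max (μ.rowLen (i + 1)) (ρ.rowLen (i + 1)) + min (μ.rowLen i) (ρ.rowLen i) := by
  let f : ℕ → ℕ := fun i =>
    max (μ.rowLen (i + 1)) (ρ.rowLen (i + 1)) + min (μ.rowLen i) (ρ.rowLen i) - ν.rowLen (i + 1)
  have hf : Antitone f := by
    refine antitone_nat_of_succ_le fun i => ?_
    have := h1 i; have := h2 i
    have := h1 (i + 1); have := h2 (i + 1)
    have := h1 (i + 2); have := h2 (i + 2)
    simp only [f, add_assoc, Nat.reduceAdd] at *
    omega
  have hN : f (max (μ.colLen 0) (ρ.colLen 0)) = 0 := by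
    have a1 := rowLen_eq_zero_of_colLen_le (le_max_left (μ.colLen 0) (ρ.colLen 0))
    have a2 := rowLen_eq_zero_of_colLen_le (le_max_right (μ.colLen 0) (ρ.colLen 0))
    have a3 := μ.rowLen_anti _ _ (Nat.le_add_right (max (μ.colLen 0) (ρ.colLen 0)) 1)
    have a4 := ρ.rowLen_anti _ _ (Nat.le_add_right (max (μ.colLen 0) (ρ.colLen 0)) 1)
    simp only [f]
    omega
  refine ⟨ofAntitone f hf _ hN, fun i => ?_⟩
  rw [rowLen_ofAntitone]
  have := h1 i; have := h2 i
  have := h1 (i + 1); have := h2 (i + 1)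
  simp only [f]
  omega

/-- Since $\max+\min=\mu_i+\rho_i$ in each row, summing the reflection identities telescopes. A
partial sum carries the boundary term $\max(\mu_N,\rho_N)$, which vanishes for large $N$. -/
theorem card_add_card_of_reflection {μ ρ κ ν : YoungDiagram} {k : ℕ}
    (h0 : ν.rowLen 0 = max (μ.rowLen 0) (ρ.rowLen 0) + k)
    (h : ∀ i, ν.rowLen (i + 1) + κ.rowLen i =
      max (μ.rowLen (i + 1)) (ρ.rowLen (i + 1)) + min (μ.rowLen i) (ρ.rowLen i)) :
    ν.card + κ.card = μ.card + ρ.card + k := by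
  set N := max (μ.colLen 0) (ρ.colLen 0)
  have a1 : μ.rowLen N = 0 := rowLen_eq_zero_of_colLen_le (le_max_left (μ.colLen 0) (ρ.colLen 0))
  have a2 : ρ.rowLen N = 0 := rowLen_eq_zero_of_colLen_le (le_max_right (μ.colLen 0) (ρ.colLen 0))
  have a3 : μ.rowLen (N + 1) = 0 := by have := μ.rowLen_anti _ _ (Nat.le_add_right N 1); omega
  have a4 : ρ.rowLen (N + 1) = 0 := by have := ρ.rowLen_anti _ _ (Nat.le_add_right N 1); omega
  have hN := h N
  have a5 : κ.rowLen N = 0 := by omega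
  have a6 : ν.rowLen (N + 1) = 0 := by omega
  have a7 : ∀ N, ∑ i ∈ Finset.range (N + 1), ν.rowLen i + ∑ i ∈ Finset.range N, κ.rowLen i =
      k + (∑ i ∈ Finset.range N, μ.rowLen i + ∑ i ∈ Finset.range N, ρ.rowLen i) +
        max (μ.rowLen N) (ρ.rowLen N) := by
    intro N
    induction N with
    | zero => simp [h0, add_comm]
    | succ N ih =>
      rw [Finset.sum_range_succ, Finset.sum_range_succ κ.rowLen, Finset.sum_range_succ μ.rowLen,
        Finset.sum_range_succ ρ.rowLen]
      have := h N
      omega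
  have := a7 N
  rw [card_eq_sum_rowLen _ a1, card_eq_sum_rowLen _ a2, card_eq_sum_rowLen _ a5,
    card_eq_sum_rowLen _ a6]
  omega

open Classical in
/-- Adding and removing horizontal strips commute up to a shift. -/
theorem card_common_strips (μ ρ : YoungDiagram) (g : ℕ) :
    ((ofCard (ρ.card + g)).filter fun ν => IsHorizontalStrip μ ν ∧ IsHorizontalStrip ρ ν).card =
    ((strips μ).filter fun κ => μ.card ≤ κ.card + g ∧ IsHorizontalStrip κ ρ).card := by
  symm
  have up : ∀ κ, IsHorizontalStrip κ μ → IsHorizontalStrip κ ρ → ∀ k, ∃ ν : YoungDiagram,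
      ν.rowLen 0 = max (μ.rowLen 0) (ρ.rowLen 0) + k ∧
      ∀ i, ν.rowLen (i + 1) + κ.rowLen i =
        max (μ.rowLen (i + 1)) (ρ.rowLen (i + 1)) + min (μ.rowLen i) (ρ.rowLen i) :=
    fun κ h1 h2 k => exists_reflection_up h1 h2 k
  choose! u hu0 hu using up
  have down : ∀ ν, IsHorizontalStrip μ ν → IsHorizontalStrip ρ ν → ∃ κ : YoungDiagram,
      ∀ i, ν.rowLen (i + 1) + κ.rowLen i =
        max (μ.rowLen (i + 1)) (ρ.rowLen (i + 1)) + min (μ.rowLen i) (ρ.rowLen i) :=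
    fun ν h1 h2 => exists_reflection_down h1 h2
  choose! d hd using down
  -- The size of $\nu$ must be $|\rho|+g$, and $|\nu|+|\kappa|=|\mu|+|\rho|+k$; this forces
  -- $k=|\kappa|+g-|\mu|$. The inequality in the filter on the right makes this subtraction exact.
  refine Finset.card_bij' (fun κ _ => u κ (κ.card + g - μ.card)) (fun ν _ => d ν) ?_ ?_ ?_ ?_
  · intro κ hκ
    simp only [Finset.mem_filter, mem_ofCard, mem_strips] at hκ ⊢
    obtain ⟨h1, h3, h2⟩ := hκ
    have h0 := hu0 κ h1 h2 (κ.card + g - μ.card)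
    have hs := hu κ h1 h2 (κ.card + g - μ.card)
    have hc := card_add_card_of_reflection h0 hs
    refine ⟨by omega, fun i => ?_, fun i => ?_⟩
    all_goals
      have := hs i
      have := h1 i
      have := h2 i
      refine ⟨?_, by omega⟩
      cases i with
      | zero => omega
      | succ i =>
        have := hs i
        have := h1 i
        have := h2 i
        omega
  · intro ν hν
    simp only [Finset.mem_filter, mem_ofCard, mem_strips] at hν ⊢
    obtain ⟨h3, h1, h2⟩ := hν
    have hs := hd ν h1 h2
    have h0 : ν.rowLen 0 = max (μ.rowLen 0) (ρ.rowLen 0) +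
        (ν.rowLen 0 - max (μ.rowLen 0) (ρ.rowLen 0)) := by
      have := h1 0
      have := h2 0
      omega
    have hc := card_add_card_of_reflection h0 hs
    have s1 : IsHorizontalStrip (d ν) μ := by
      intro i
      have := hs i
      have := h1 i; have := h2 i
      have := h1 (i + 1); have := h2 (i + 1)
      omega
    have s2 : IsHorizontalStrip (d ν) ρ := by
      intro i
      have := hs i
      have := h1 i; have := h2 i
      have := h1 (i + 1); have := h2 (i + 1)
      omega
    have := s2.card_le
    exact ⟨s1, by omega, s2⟩
  · intro κ hκ
    simp only [Finset.mem_filter, mem_strips] at hκ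
    obtain ⟨h1, h3, h2⟩ := hκ
    have h0 := hu0 κ h1 h2 (κ.card + g - μ.card)
    have hs := hu κ h1 h2 (κ.card + g - μ.card)
    have key : IsHorizontalStrip μ (u κ (κ.card + g - μ.card)) ∧
        IsHorizontalStrip ρ (u κ (κ.card + g - μ.card)) := by
      refine ⟨fun i => ?_, fun i => ?_⟩
      all_goals
        have := hs i
        have := h1 i
        have := h2 i
        refine ⟨?_, by omega⟩
        cases i with
        | zero => omega
        | succ i =>
          have := hs i
          have := h1 i
          have := h2 i
          omega
    have hs' := hd _ key.1 key.2
    refine ext_rowLen fun i => ?_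
    have := hs i
    have := hs' i
    omega
  · intro ν hν
    simp only [Finset.mem_filter, mem_ofCard] at hν
    obtain ⟨h3, h1, h2⟩ := hν
    have hs := hd ν h1 h2
    have h0 : ν.rowLen 0 = max (μ.rowLen 0) (ρ.rowLen 0) +
        (ν.rowLen 0 - max (μ.rowLen 0) (ρ.rowLen 0)) := by
      have := h1 0
      have := h2 0
      omega
    have hc := card_add_card_of_reflection h0 hs
    have s1 : IsHorizontalStrip (d ν) μ := by
      intro i
      have := hs i
      have := h1 i; have := h2 i
      have := h1 (i + 1); have := h2 (i + 1)
      omega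
    have s2 : IsHorizontalStrip (d ν) ρ := by
      intro i
      have := hs i
      have := h1 i; have := h2 i
      have := h1 (i + 1); have := h2 (i + 1)
      omega
    have g0 := hu0 _ s1 s2 ((d ν).card + g - μ.card)
    have gs := hu _ s1 s2 ((d ν).card + g - μ.card)
    refine ext_rowLen fun i => ?_
    cases i with
    | zero => omega
    | succ i =>
      have := hs i
      have := gs i
      omega

end YoungDiagram

/-! ### Semistandard tableaux and Kostka numbers -/

section SchurFunctions

open YoungDiagram

/-- The Kostka number: the number of semistandard tableaux of shape `μ` and content `m`. -/
noncomputable def kostka (μ : YoungDiagram) (m : ℕ →₀ ℕ) : ℕ :=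
  Nat.card {T : SemistandardYoungTableau μ // ssytContent T = m}

theorem coeff_schurFunction (μ : YoungDiagram) (m : ℕ →₀ ℕ) :
    MvPowerSeries.coeff m (schurFunction μ) = kostka μ m := rfl

theorem ssytContent_apply {μ : YoungDiagram} (T : SemistandardYoungTableau μ) (a : ℕ) :
    ssytContent T a = (μ.cells.filter fun c => T c.1 c.2 = a).card := by
  rw [ssytContent, Finsupp.finsetSum_apply, Finset.card_filter]
  simp only [Finsupp.single_apply]

theorem ssytContent_entry_ne_zero {μ : YoungDiagram} (T : SemistandardYoungTableau μ) {i j : ℕ}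
    (h : (i, j) ∈ μ) : ssytContent T (T i j) ≠ 0 := by
  rw [ssytContent_apply]
  exact Finset.card_ne_zero.2 ⟨(i, j), Finset.mem_filter.2 ⟨(mem_cells _).2 h, rfl⟩⟩

theorem degree_ssytContent {μ : YoungDiagram} (T : SemistandardYoungTableau μ) :
    (ssytContent T).degree = μ.card := by
  simp [ssytContent, map_sum, YoungDiagram.card]

/-- The entries on the cells lie in the finite support of the content, and the entries elsewhere are
0. Without finiteness `Nat.card` would return the default 0. -/
instance finite_ssyt_of_content (μ : YoungDiagram) (m : ℕ →₀ ℕ) :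
    Finite {T : SemistandardYoungTableau μ // ssytContent T = m} := by
  let F : {T : SemistandardYoungTableau μ // ssytContent T = m} → (μ.cells → m.support) :=
    fun T c => ⟨T.1 c.1.1 c.1.2, Finsupp.mem_support_iff.2 (by
      have := ssytContent_entry_ne_zero T.1 (i := c.1.1) (j := c.1.2) ((mem_cells _).1 c.2)
      rwa [T.2] at this)⟩
  refine Finite.of_injective F fun T T' h =>
    Subtype.ext (SemistandardYoungTableau.ext fun i j => ?_)
  by_cases hc : (i, j) ∈ μ
  · exact congrArg Subtype.val (congrFun h ⟨(i, j), (mem_cells _).2 hc⟩)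
  · rw [T.1.zeros hc, T'.1.zeros hc]

theorem kostka_eq_zero_of_degree_ne {μ : YoungDiagram} {m : ℕ →₀ ℕ} (h : m.degree ≠ μ.card) :
    kostka μ m = 0 := by
  have : IsEmpty {T : SemistandardYoungTableau μ // ssytContent T = m} :=
    ⟨fun T => h (by rw [← T.2, degree_ssytContent])⟩
  exact Nat.card_of_isEmpty

theorem YoungDiagram.IsHorizontalStrip.le {κ μ : YoungDiagram} (h : IsHorizontalStrip κ μ) :
    κ ≤ μ := by
  rintro ⟨i, j⟩ hc
  have hc : (i, j) ∈ κ := hc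
  change (i, j) ∈ μ
  rw [mem_iff_lt_rowLen] at hc ⊢
  exact hc.trans_le (h i).1

namespace SemistandardYoungTableau

/-- Fill the horizontal strip `μ / κ` with a new largest entry `N`. -/
def extend {κ μ : YoungDiagram} (h : IsHorizontalStrip κ μ) (T : SemistandardYoungTableau κ)
    (N : ℕ) (hT : ∀ i j, (i, j) ∈ κ → T i j < N) : SemistandardYoungTableau μ where
  entry i j := if (i, j) ∈ κ then T i j else if (i, j) ∈ μ then N else 0
  row_weak' := by
    intro i j1 j2 hj hc
    by_cases h2 : (i, j2) ∈ κ
    · rw [if_pos h2, if_pos (κ.up_left_mem le_rfl hj.le h2)]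
      exact T.row_weak hj h2
    · rw [if_neg h2, if_pos hc]
      split_ifs with h1
      · exact (hT _ _ h1).le
      · exact le_rfl
      · exact Nat.zero_le _
  col_strict' := by
    intro i1 i2 j hi hc
    by_cases h2 : (i2, j) ∈ κ
    · rw [if_pos h2, if_pos (κ.up_left_mem hi.le le_rfl h2)]
      exact T.col_strict hi h2
    · have h1 : (i1, j) ∈ κ := by
        rw [mem_iff_lt_rowLen] at hc ⊢
        have := μ.rowLen_anti _ _ (Nat.succ_le_of_lt hi)
        have := (h i1).2
        simp only [Nat.succ_eq_add_one] at *
        omega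
      rw [if_neg h2, if_pos hc, if_pos h1]
      exact hT _ _ h1
  zeros' := by
    intro i j hc
    rw [if_neg fun h' => hc (h.le h'), if_neg hc]

theorem extend_apply {κ μ : YoungDiagram} (h : IsHorizontalStrip κ μ)
    (T : SemistandardYoungTableau κ) (N : ℕ) (hT : ∀ i j, (i, j) ∈ κ → T i j < N) (i j : ℕ) :
    T.extend h N hT i j = if (i, j) ∈ κ then T i j else if (i, j) ∈ μ then N else 0 := rfl

theorem ssytContent_extend {κ μ : YoungDiagram} (h : IsHorizontalStrip κ μ)
    (T : SemistandardYoungTableau κ) (N : ℕ) (hT : ∀ i j, (i, j) ∈ κ → T i j < N) :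
    ssytContent (T.extend h N hT) = ssytContent T + Finsupp.single N (μ.card - κ.card) := by
  rw [ssytContent, ssytContent, ← Finset.sum_sdiff (cells_subset_iff.2 h.le), add_comm]
  congr 1
  · refine Finset.sum_congr rfl fun c hc => ?_
    rw [extend_apply, if_pos ((mem_cells _).1 hc)]
  · rw [Finset.sum_congr rfl (g := fun _ => Finsupp.single N 1)]
    · rw [Finset.sum_const, Finsupp.smul_single, smul_eq_mul, mul_one,
        Finset.card_sdiff_of_subset (cells_subset_iff.2 h.le)]
    · intro c hc
      rw [Finset.mem_sdiff, mem_cells, mem_cells] at hc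
      rw [extend_apply, if_neg hc.2, if_pos hc.1]

/-- The shape of the part of a tableau with entries below `N`. -/
def shapeBelow {μ : YoungDiagram} (T : SemistandardYoungTableau μ) (N : ℕ) : YoungDiagram where
  cells := μ.cells.filter fun c => T c.1 c.2 < N
  isLowerSet := by
    rintro ⟨i, j⟩ ⟨i', j'⟩ ⟨h1, h2⟩ h
    simp only [Finset.coe_filter, mem_cells, Set.mem_ofPred_eq] at h ⊢
    refine ⟨μ.up_left_mem h1 h2 h.1, lt_of_le_of_lt ?_ h.2⟩
    exact (T.col_weak h1 (μ.up_left_mem le_rfl h2 h.1)).trans (T.row_weak_of_le h2 h.1)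

theorem mem_shapeBelow {μ : YoungDiagram} (T : SemistandardYoungTableau μ) {N i j : ℕ} :
    (i, j) ∈ T.shapeBelow N ↔ (i, j) ∈ μ ∧ T i j < N := by
  rw [← mem_cells]
  simp [shapeBelow]

/-- The part of a tableau with entries below `N`. -/
def restrictBelow {μ : YoungDiagram} (T : SemistandardYoungTableau μ) (N : ℕ) :
    SemistandardYoungTableau (T.shapeBelow N) where
  entry i j := if (i, j) ∈ T.shapeBelow N then T i j else 0
  row_weak' := by
    intro i j1 j2 hj hc
    rw [if_pos hc, if_pos (up_left_mem _ le_rfl hj.le hc)]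
    exact T.row_weak hj (T.mem_shapeBelow.1 hc).1
  col_strict' := by
    intro i1 i2 j hi hc
    rw [if_pos hc, if_pos (up_left_mem _ hi.le le_rfl hc)]
    exact T.col_strict hi (T.mem_shapeBelow.1 hc).1
  zeros' hc := if_neg hc

theorem restrictBelow_apply {μ : YoungDiagram} (T : SemistandardYoungTableau μ) {N i j : ℕ}
    (h : (i, j) ∈ T.shapeBelow N) : T.restrictBelow N i j = T i j := if_pos h

theorem isHorizontalStrip_shapeBelow {μ : YoungDiagram} (T : SemistandardYoungTableau μ) {N : ℕ}
    (hT : ∀ i j, (i, j) ∈ μ → T i j ≤ N) : IsHorizontalStrip (T.shapeBelow N) μ := by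
  intro i
  constructor
  · by_contra! h
    have := mem_iff_lt_rowLen.2 h
    rw [mem_shapeBelow, mem_iff_lt_rowLen] at this
    exact lt_irrefl _ this.1
  · by_contra! h
    have h1 := mem_iff_lt_rowLen.2 h
    refine lt_irrefl _ (mem_iff_lt_rowLen.1 (T.mem_shapeBelow.2
      ⟨μ.up_left_mem (Nat.le_succ i) le_rfl h1, ?_⟩))
    exact (T.col_strict (Nat.lt_succ_self i) h1).trans_le (hT _ _ h1)

end SemistandardYoungTableau

theorem entry_lt_of_content {μ : YoungDiagram} (T : SemistandardYoungTableau μ) {N : ℕ}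
    (h : ∀ i, N ≤ i → ssytContent T i = 0) (i j : ℕ) (hc : (i, j) ∈ μ) : T i j < N := by
  by_contra! h'
  exact ssytContent_entry_ne_zero T hc (h _ h')

/-- Remove the largest entry from the tableaux of a given shape. -/
theorem kostka_add_single (μ : YoungDiagram) (N : ℕ) (β : ℕ →₀ ℕ) (hβ : ∀ i, N ≤ i → β i = 0)
    (b : ℕ) : kostka μ (β + Finsupp.single N b) =
      ∑ κ ∈ (strips μ).filter (fun κ => μ.card = κ.card + b), kostka κ β := by
  classical
  set S := (strips μ).filter (fun κ => μ.card = κ.card + b) with hS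
  have hmem : ∀ κ : S, IsHorizontalStrip κ.1 μ ∧ μ.card = κ.1.card + b := by
    rintro ⟨κ, hκ⟩
    simpa [hS] using hκ
  have hlt : ∀ (κ : S) (T : {T : SemistandardYoungTableau κ.1 // ssytContent T = β}) (i j),
      (i, j) ∈ κ.1 → T.1 i j < N := fun κ T =>
    entry_lt_of_content T.1 (by rw [T.2]; exact hβ)
  let F : (Σ κ : S, {T : SemistandardYoungTableau κ.1 // ssytContent T = β}) →
      {T : SemistandardYoungTableau μ // ssytContent T = β + Finsupp.single N b} := fun p =>
    ⟨p.2.1.extend (hmem p.1).1 N (hlt p.1 p.2), by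
      rw [SemistandardYoungTableau.ssytContent_extend, p.2.2, (hmem p.1).2,
        Nat.add_sub_cancel_left]⟩
  have hF : Function.Bijective F := by
    constructor
    · have hmemκ : ∀ p i j, (i, j) ∈ p.1.1 ↔ (i, j) ∈ μ ∧ (F p).1 i j < N := by
        intro p i j
        change _ ↔ _ ∧ p.2.1.extend (hmem p.1).1 N (hlt p.1 p.2) i j < N
        rw [SemistandardYoungTableau.extend_apply]
        by_cases h : (i, j) ∈ p.1.1
        · simpa [h, hlt p.1 p.2 i j h] using (hmem p.1).1.le h
        · simp only [h, if_false, false_iff, not_and, not_lt]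
          intro h'
          rw [if_pos h']
      rintro p q h
      have h1 : p.1 = q.1 := by
        refine Subtype.ext (YoungDiagram.ext (Finset.ext ?_))
        rintro ⟨i, j⟩
        rw [mem_cells, mem_cells, hmemκ, hmemκ, h]
      obtain ⟨κ, T⟩ := p
      obtain ⟨κ', T'⟩ := q
      cases h1
      congr 1
      refine Subtype.ext (SemistandardYoungTableau.ext fun i j => ?_)
      by_cases hc : (i, j) ∈ κ.1
      · have := congrArg (fun T => T.1 i j) h
        simpa only [F, SemistandardYoungTableau.extend_apply, if_pos hc] using this
      · rw [T.1.zeros hc, T'.1.zeros hc]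
    · rintro ⟨T, hT⟩
      have hle : ∀ i j, (i, j) ∈ μ → T i j ≤ N := fun i j hc => Nat.lt_succ_iff.1
        (entry_lt_of_content T (by
          intro a ha
          rw [hT, Finsupp.add_apply, hβ a (Nat.le_of_succ_le ha), Finsupp.single_apply,
            if_neg (Nat.ne_of_lt ha), add_zero]) i j hc)
      -- Strictness down columns allows at most one entry $N$ per column, so the cells filled with
      -- $N$ form a horizontal strip.
      have hs := T.isHorizontalStrip_shapeBelow hle
      have hlt' : ∀ i j, (i, j) ∈ T.shapeBelow N → T.restrictBelow N i j < N := by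
        intro i j hc
        rw [T.restrictBelow_apply hc]
        exact (T.mem_shapeBelow.1 hc).2
      have hext : (T.restrictBelow N).extend hs N hlt' = T := by
        refine SemistandardYoungTableau.ext fun i j => ?_
        rw [SemistandardYoungTableau.extend_apply]
        split_ifs with h1 h2
        · exact T.restrictBelow_apply h1
        · rw [T.mem_shapeBelow, not_and, not_lt] at h1
          exact le_antisymm (h1 h2) (hle _ _ h2)
        · exact (T.zeros h2).symm
      have hcont := SemistandardYoungTableau.ssytContent_extend hs _ N hlt'
      rw [hext, hT] at hcont
      have hN : ssytContent (T.restrictBelow N) N = 0 := by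
        rw [ssytContent_apply, Finset.card_eq_zero, Finset.filter_eq_empty_iff]
        rintro ⟨i, j⟩ hc
        exact (hlt' i j ((mem_cells _).1 hc)).ne
      have hb : b = μ.card - (T.shapeBelow N).card := by
        have := DFunLike.congr_fun hcont N
        simpa [hβ N le_rfl, hN] using this
      have hc : ssytContent (T.restrictBelow N) = β := by
        rw [← hb] at hcont
        exact (add_right_cancel hcont).symm
      have hmS : T.shapeBelow N ∈ S := by
        rw [hS, Finset.mem_filter, mem_strips]
        have := hs.card_le
        exact ⟨hs, by omega⟩
      exact ⟨⟨⟨T.shapeBelow N, hmS⟩, ⟨T.restrictBelow N, hc⟩⟩, Subtype.ext hext⟩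
  have := Nat.card_congr (Equiv.ofBijective F hF)
  rw [Nat.card_sigma] at this
  rw [kostka, ← this, ← Finset.sum_coe_sort S]
  rfl

/-- The row lengths of a Young diagram as a finitely supported function. -/
noncomputable def YoungDiagram.rowFinsupp (μ : YoungDiagram) : ℕ →₀ ℕ :=
  Finsupp.onFinset (Finset.range (μ.colLen 0)) μ.rowLen fun i hi => by
    rw [Finset.mem_range]
    by_contra! h
    exact hi (rowLen_eq_zero_of_colLen_le h)

@[simp] theorem YoungDiagram.rowFinsupp_apply (μ : YoungDiagram) (i : ℕ) :
    μ.rowFinsupp i = μ.rowLen i := rfl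

theorem ssytContent_highestWeight (μ : YoungDiagram) :
    ssytContent (SemistandardYoungTableau.highestWeight μ) = μ.rowFinsupp := by
  ext i
  rw [ssytContent_apply, rowFinsupp_apply, rowLen_eq_card, row]
  congr 1
  refine Finset.filter_congr fun c hc => ?_
  rw [SemistandardYoungTableau.highestWeight_apply, if_pos ((mem_cells _).1 hc)]

theorem YoungDiagram.degree_rowFinsupp (μ : YoungDiagram) : μ.rowFinsupp.degree = μ.card := by
  rw [← ssytContent_highestWeight, degree_ssytContent]

theorem YoungDiagram.rowFinsupp_injective : Function.Injective rowFinsupp := fun _ _ h =>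
  ext_rowLen fun i => DFunLike.congr_fun h i

/-- The weighted sum `∑ i * m i` of the exponents. -/
noncomputable def weightSum : (ℕ →₀ ℕ) →+ ℕ :=
  Finsupp.liftAddHom fun i => AddMonoidHom.mulLeft i

theorem weightSum_ssytContent {μ : YoungDiagram} (T : SemistandardYoungTableau μ) :
    weightSum (ssytContent T) = ∑ c ∈ μ.cells, T c.1 c.2 := by
  rw [ssytContent, map_sum]
  simp [weightSum]

theorem SemistandardYoungTableau.row_le {μ : YoungDiagram} (T : SemistandardYoungTableau μ)
    {i j : ℕ} (h : (i, j) ∈ μ) : i ≤ T i j := by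
  induction i with
  | zero => exact Nat.zero_le _
  | succ i ih =>
    exact Nat.succ_le_of_lt ((ih (μ.up_left_mem (Nat.le_succ i) le_rfl h)).trans_lt
      (T.col_strict (Nat.lt_succ_self i) h))

theorem weightSum_rowFinsupp (μ : YoungDiagram) :
    weightSum μ.rowFinsupp = ∑ c ∈ μ.cells, c.1 := by
  rw [← ssytContent_highestWeight, weightSum_ssytContent]
  refine Finset.sum_congr rfl fun c hc => ?_
  rw [SemistandardYoungTableau.highestWeight_apply, if_pos ((mem_cells _).1 hc)]

/-- Every entry in row $i$ is at least $i$, so the sum of the entries is minimal exactly when every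
entry equals its row index. -/
theorem eq_highestWeight_of_weightSum_le {μ : YoungDiagram} (T : SemistandardYoungTableau μ)
    (h : weightSum (ssytContent T) ≤ weightSum μ.rowFinsupp) :
    T = SemistandardYoungTableau.highestWeight μ := by
  rw [weightSum_ssytContent, weightSum_rowFinsupp] at h
  have hle : ∀ c ∈ μ.cells, c.1 ≤ T c.1 c.2 := fun c hc => T.row_le ((mem_cells _).1 hc)
  have heq := (Finset.sum_eq_sum_iff_of_le hle).1 (le_antisymm (Finset.sum_le_sum hle) h)
  refine SemistandardYoungTableau.ext fun i j => ?_
  rw [SemistandardYoungTableau.highestWeight_apply]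
  split_ifs with hc
  · exact (heq (i, j) ((mem_cells _).2 hc)).symm
  · exact T.zeros hc

theorem kostka_rowFinsupp_self (μ : YoungDiagram) : kostka μ μ.rowFinsupp = 1 := by
  rw [kostka, Nat.card_eq_one_iff_unique]
  refine ⟨⟨fun T T' => Subtype.ext ?_⟩, ⟨⟨_, ssytContent_highestWeight μ⟩⟩⟩
  rw [eq_highestWeight_of_weightSum_le T.1 (by rw [T.2]),
    eq_highestWeight_of_weightSum_le T'.1 (by rw [T'.2])]

/-- Together with `kostka_rowFinsupp_self` this is the unitriangularity of the Kostka matrix. The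
integer `weightSum` replaces the dominance order, so that minimum arguments and strong induction
apply directly. -/
theorem kostka_eq_zero_of_weightSum_le {μ ν : YoungDiagram}
    (h : weightSum ν.rowFinsupp ≤ weightSum μ.rowFinsupp) (hne : ν ≠ μ) :
    kostka μ ν.rowFinsupp = 0 := by
  have : IsEmpty {T : SemistandardYoungTableau μ // ssytContent T = ν.rowFinsupp} := by
    refine ⟨fun T => hne (rowFinsupp_injective ?_)⟩
    rw [← T.2, eq_highestWeight_of_weightSum_le T.1 (by rwa [T.2]), ssytContent_highestWeight]
  exact Nat.card_of_isEmpty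

/-! ### Pieri's rule and products of complete symmetric functions -/

theorem sum_Iic_add_single {M : Type*} [AddCommMonoid M] (f : (ℕ →₀ ℕ) → M) (β : ℕ →₀ ℕ) (N g : ℕ)
    (hβ : β N = 0) : ∑ x ∈ Finset.Iic (β + Finsupp.single N g), f x =
      ∑ b ∈ Finset.range (g + 1), ∑ x ∈ Finset.Iic β, f (x + Finsupp.single N b) := by
  rw [← Finset.sum_product']
  refine Finset.sum_bij' (fun x _ => (x N, x.erase N)) (fun p _ => p.2 + Finsupp.single N p.1)
    ?_ ?_ ?_ ?_ ?_
  · intro x hx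
    rw [Finset.mem_Iic] at hx
    simp only [Finset.mem_product, Finset.mem_range, Finset.mem_Iic]
    have := hx N
    simp only [Finsupp.add_apply, hβ, Finsupp.single_eq_same] at this
    refine ⟨by omega, fun i => ?_⟩
    by_cases hi : i = N
    · simp [hi]
    · have := hx i
      rw [Finsupp.erase_ne hi]
      simpa [hi] using this
  · rintro ⟨b, x⟩ h
    simp only [Finset.mem_product, Finset.mem_range, Finset.mem_Iic] at h ⊢
    exact add_le_add h.2 (Finsupp.single_le_single.2 (by omega))
  · intro x _
    exact Finsupp.erase_add_single N x
  · rintro ⟨b, x⟩ h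
    simp only [Finset.mem_product, Finset.mem_range, Finset.mem_Iic] at h
    have h0 : x N = 0 := by have := h.2 N; omega
    ext1
    · simp [h0]
    · ext i
      by_cases hi : i = N
      · simp [hi, h0]
      · simp [Finsupp.erase_ne hi]
  · intro x _
    rw [Finsupp.erase_add_single N x]

theorem kostka_bot_zero : kostka ⊥ 0 = 1 := by
  have h : (⊥ : YoungDiagram).rowFinsupp = 0 := by
    ext i
    rw [rowFinsupp_apply, rowLen_eq_card, row]
    simp
  rw [← h, kostka_rowFinsupp_self]

theorem YoungDiagram.eq_bot_of_card_eq_zero {μ : YoungDiagram} (h : μ.card = 0) : μ = ⊥ :=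
  YoungDiagram.ext (by rw [Finset.card_eq_zero.1 h, cells_bot])

open Classical in
/-- Pieri's rule for the sum of all monomials, coefficient by coefficient. -/
theorem sum_kostka_superstrips (γ : ℕ →₀ ℕ) : ∀ μ : YoungDiagram,
    ∑ lam ∈ (ofCard γ.degree).filter (fun lam => IsHorizontalStrip μ lam), kostka lam γ =
      ∑ β ∈ Finset.Iic γ, kostka μ β := by
  induction γ using Finsupp.induction_on_max with
  | zero =>
    intro μ
    have h0 : Finset.Iic (0 : ℕ →₀ ℕ) = {0} := by
      ext x
      simp
    rw [h0, Finset.sum_singleton]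
    by_cases hμ : μ = ⊥
    · subst hμ
      rw [Finset.sum_eq_single_of_mem ⊥]
      · rw [Finset.mem_filter, mem_ofCard]
        exact ⟨by simp [YoungDiagram.card], fun i => ⟨le_rfl, rowLen_anti _ _ _ (Nat.le_succ i)⟩⟩
      · intro lam hlam hne
        rw [Finset.mem_filter, mem_ofCard, map_zero] at hlam
        exact absurd (eq_bot_of_card_eq_zero hlam.1) hne
    · have hc : μ.card ≠ 0 := fun h => hμ (eq_bot_of_card_eq_zero h)
      rw [kostka_eq_zero_of_degree_ne (by rw [map_zero]; exact hc.symm)]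
      refine Finset.sum_eq_zero fun lam hlam => ?_
      rw [Finset.mem_filter, mem_ofCard, map_zero] at hlam
      have := hlam.2.card_le
      omega
  | single_add N g β hβ _ ih =>
    intro μ
    have hβ' : ∀ i, N ≤ i → β i = 0 := by
      intro i hi
      by_contra h
      exact absurd (hβ i (Finsupp.mem_support_iff.2 h)) (not_lt.2 hi)
    -- The largest letter $N$ is stripped from both sides. Expressed through the numbers
    -- $K_{\rho\beta}$ with $|\rho|=|\beta|$, the left side counts common superstrips of $\mu$ and
    -- $\rho$, and the right side, after the induction hypothesis, common substrips.
    rw [add_comm (Finsupp.single N g) β, sum_Iic_add_single _ _ _ _ (hβ' N le_rfl)]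
    have hdeg : (β + Finsupp.single N g).degree = β.degree + g := by simp
    have hR : ∀ b ∈ Finset.range (g + 1), ∑ x ∈ Finset.Iic β, kostka μ (x + Finsupp.single N b) =
        ∑ κ ∈ (strips μ).filter (fun κ => μ.card = κ.card + b), ∑ x ∈ Finset.Iic β, kostka κ x := by
      intro b _
      rw [Finset.sum_comm]
      refine Finset.sum_congr rfl fun x hx => kostka_add_single _ _ _ (fun i hi => ?_) _
      have := Finset.mem_Iic.1 hx i
      have := hβ' i hi
      omega
    rw [Finset.sum_congr rfl hR, hdeg]
    have hL : ∀ lam ∈ (ofCard (β.degree + g)).filter (fun lam => IsHorizontalStrip μ lam),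
        kostka lam (β + Finsupp.single N g) =
          ∑ ρ ∈ ofCard β.degree, if IsHorizontalStrip ρ lam then kostka ρ β else 0 := by
      intro lam hlam
      rw [Finset.mem_filter, mem_ofCard] at hlam
      rw [kostka_add_single _ _ _ hβ', ← Finset.sum_filter]
      refine Finset.sum_congr (Finset.ext fun ρ => ?_) fun _ _ => rfl
      simp only [Finset.mem_filter, mem_strips, mem_ofCard]
      exact ⟨fun h => ⟨by omega, h.1⟩, fun h => ⟨h.2, by omega⟩⟩
    rw [Finset.sum_congr rfl hL, Finset.sum_comm]
    simp_rw [← ih, Finset.sum_filter]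
    conv_rhs => rw [Finset.sum_comm]
    -- For a given $\kappa$ only $b=|\mu|-|\kappa|$ contributes, and it is in range exactly when
    -- $|\mu|\le|\kappa|+g$.
    have hM : ∀ κ ∈ strips μ, ∑ b ∈ Finset.range (g + 1), (if μ.card = κ.card + b then
        ∑ ρ ∈ ofCard β.degree, if IsHorizontalStrip κ ρ then kostka ρ β else 0 else 0) =
        ∑ ρ ∈ ofCard β.degree,
          if μ.card ≤ κ.card + g ∧ IsHorizontalStrip κ ρ then kostka ρ β else 0 := by
      intro κ hκ
      have hle := (mem_strips.1 hκ).card_le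
      by_cases h : μ.card ≤ κ.card + g
      · rw [Finset.sum_eq_single_of_mem (μ.card - κ.card)]
        · rw [if_pos (by omega)]
          simp only [h, true_and]
        · rw [Finset.mem_range]
          omega
        · intro b _ hb
          rw [if_neg (by omega)]
      · simp only [h, false_and, if_false, Finset.sum_const_zero]
        refine Finset.sum_eq_zero fun b hb => if_neg ?_
        rw [Finset.mem_range] at hb
        omega
    rw [Finset.sum_congr rfl hM]
    conv_rhs => rw [Finset.sum_comm]
    refine Finset.sum_congr rfl fun ρ hρ => ?_
    rw [mem_ofCard] at hρ
    rw [← hρ]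
    have := card_common_strips μ ρ g
    simp_rw [← ite_and, ← Finset.sum_filter, Finset.sum_const, this]

/-- The complete homogeneous symmetric function of degree `k`. -/
noncomputable def completeSymm (k : ℕ) : MvPowerSeries ℕ ℤ := fun m => if m.degree = k then 1 else 0

theorem coeff_completeSymm (k : ℕ) (m : ℕ →₀ ℕ) :
    MvPowerSeries.coeff m (completeSymm k) = if m.degree = k then 1 else 0 := rfl

theorem completeSymm_zero : completeSymm 0 = 1 := by
  classical
  ext m
  rw [coeff_completeSymm, MvPowerSeries.coeff_one]
  simp only [Finsupp.degree_eq_zero_iff]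

open Classical in
/-- Pieri's rule. -/
theorem completeSymm_mul_schurFunction (k : ℕ) (μ : YoungDiagram) :
    completeSymm k * schurFunction μ =
      ∑ lam ∈ (ofCard (μ.card + k)).filter (fun lam => IsHorizontalStrip μ lam),
        schurFunction lam := by
  ext γ
  rw [MvPowerSeries.coeff_mul, map_sum]
  simp only [coeff_completeSymm, coeff_schurFunction]
  by_cases h : γ.degree = μ.card + k
  · rw [← h, ← Nat.cast_sum, sum_kostka_superstrips, Nat.cast_sum]
    -- Only $\beta$ of degree $|\mu|$ has a nonzero Kostka number, and then $\gamma-\beta$ has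
    -- degree $k$ automatically; so the sum over all $\beta\le\gamma$ already picks out $h_k$.
    refine Finset.sum_bij_ne_zero (fun p _ _ => p.2) ?_ ?_ ?_ ?_
    · intro p hp _
      rw [Finset.mem_Iic, ← Finset.HasAntidiagonal.mem_antidiagonal.1 hp]
      exact le_add_self
    · rintro p hp _ q hq _ hpq
      have h1 := Finset.HasAntidiagonal.mem_antidiagonal.1 hp
      rw [← Finset.HasAntidiagonal.mem_antidiagonal.1 hq, hpq] at h1
      exact Prod.ext (add_right_cancel h1) hpq
    · intro β hβ hne
      have hβ' := Finset.mem_Iic.1 hβ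
      have hd : β.degree = μ.card := by
        by_contra hd
        exact hne (by rw [kostka_eq_zero_of_degree_ne hd, Nat.cast_zero])
      have hsub : (γ - β) + β = γ := tsub_add_cancel_of_le hβ'
      have hd' : (γ - β).degree = k := by
        have := congrArg Finsupp.degree hsub
        rw [map_add] at this
        omega
      refine ⟨(γ - β, β), Finset.HasAntidiagonal.mem_antidiagonal.2 hsub, ?_, rfl⟩
      simpa [hd'] using hne
    · intro p _ hne
      rw [if_pos (by_contra fun h' => hne (by rw [if_neg h', zero_mul])), one_mul]
  · rw [Finset.sum_eq_zero, Finset.sum_eq_zero]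
    · intro lam hlam
      rw [Finset.mem_filter, mem_ofCard] at hlam
      rw [kostka_eq_zero_of_degree_ne (by omega), Nat.cast_zero]
    · intro p hp
      have := congrArg Finsupp.degree (Finset.HasAntidiagonal.mem_antidiagonal.1 hp)
      rw [map_add] at this
      by_cases h1 : p.1.degree = k
      · rw [kostka_eq_zero_of_degree_ne (by omega), Nat.cast_zero, mul_zero]
      · rw [if_neg h1, zero_mul]

/-- The product of the complete homogeneous symmetric functions of degrees `α 0, α 1, …`. -/
noncomputable def completeSymmProd (α : ℕ →₀ ℕ) : MvPowerSeries ℕ ℤ :=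
  α.prod fun _ k => completeSymm k

theorem completeSymmProd_single_add {N g : ℕ} {β : ℕ →₀ ℕ} (hβ : ∀ c ∈ β.support, c < N) :
    completeSymmProd (Finsupp.single N g + β) = completeSymm g * completeSymmProd β := by
  classical
  rw [completeSymmProd, Finsupp.prod_add_index_of_disjoint, Finsupp.prod_single_index,
    completeSymmProd]
  · exact completeSymm_zero
  · refine Finset.disjoint_of_subset_left Finsupp.support_single_subset
      (Finset.disjoint_singleton_left.2 fun h => lt_irrefl _ (hβ _ h))

theorem schurFunction_bot : schurFunction ⊥ = 1 := by
  classical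
  ext m
  rw [coeff_schurFunction, MvPowerSeries.coeff_one]
  by_cases h : m = 0
  · rw [h, if_pos rfl, kostka_bot_zero, Nat.cast_one]
  · rw [if_neg h, kostka_eq_zero_of_degree_ne, Nat.cast_zero]
    rw [show (⊥ : YoungDiagram).card = 0 by simp [YoungDiagram.card]]
    rwa [Ne, Finsupp.degree_eq_zero_iff]

/-- Multiplication by $h_g$ adds a horizontal strip of size $g$, and so does entering a new largest
letter $g$ times in a tableau. Iteration of Pieri's rule therefore builds the Kostka numbers one
letter at a time. -/
theorem completeSymmProd_eq_sum (α : ℕ →₀ ℕ) :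
    completeSymmProd α = ∑ lam ∈ ofCard α.degree, (kostka lam α : ℤ) • schurFunction lam := by
  classical
  induction α using Finsupp.induction_on_max with
  | zero =>
    rw [map_zero, Finset.sum_eq_single_of_mem ⊥]
    · rw [kostka_bot_zero, schurFunction_bot, completeSymmProd, Finsupp.prod_zero_index]
      simp
    · simp [YoungDiagram.card]
    · intro lam hlam hne
      exact absurd (eq_bot_of_card_eq_zero (mem_ofCard.1 hlam)) hne
  | single_add N g β hβ _ ih =>
    have hβ' : ∀ i, N ≤ i → β i = 0 := by
      intro i hi
      by_contra h
      exact absurd (hβ i (Finsupp.mem_support_iff.2 h)) (not_lt.2 hi)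
    rw [completeSymmProd_single_add hβ, ih, Finset.mul_sum]
    have hdeg : (Finsupp.single N g + β).degree = β.degree + g := by simp [add_comm]
    have h1 : ∀ μ ∈ ofCard β.degree, completeSymm g * ((kostka μ β : ℤ) • schurFunction μ) =
        ∑ lam ∈ ofCard (β.degree + g), if IsHorizontalStrip μ lam then
          (kostka μ β : ℤ) • schurFunction lam else 0 := by
      intro μ hμ
      rw [mul_smul_comm, completeSymm_mul_schurFunction, mem_ofCard.1 hμ, Finset.smul_sum,
        Finset.sum_filter]
    rw [Finset.sum_congr rfl h1, Finset.sum_comm, hdeg]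
    refine Finset.sum_congr rfl fun lam hlam => ?_
    rw [add_comm _ β, kostka_add_single _ _ _ hβ', Nat.cast_sum, Finset.sum_smul,
      ← Finset.sum_filter]
    refine Finset.sum_congr (Finset.ext fun ρ => ?_) fun _ _ => rfl
    rw [mem_ofCard] at hlam
    simp only [Finset.mem_filter, mem_strips, mem_ofCard]
    exact ⟨fun h => ⟨h.2, by omega⟩, fun h => ⟨by omega, h.1⟩⟩

/-! ### Independence of Schur functions and existence of the Schur expansion -/

/-- In a linear relation, take a shape $\mu$ of least `weightSum` with nonzero coefficient. By
triangularity no other term contains the monomial $x^\mu$. -/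
theorem linearIndependent_schurFunction : LinearIndependent ℤ schurFunction := by
  rw [linearIndependent_iff]
  intro l hl
  by_contra hne
  obtain ⟨μ, hμ, hmin⟩ := Finset.exists_min_image l.support
    (fun ν => weightSum ν.rowFinsupp) (Finsupp.support_nonempty_iff.2 hne)
  have h := congrArg (MvPowerSeries.coeff μ.rowFinsupp) hl
  rw [Finsupp.linearCombination_apply, Finsupp.sum, map_sum, map_zero,
    Finset.sum_eq_single_of_mem μ hμ] at h
  · rw [map_smul, coeff_schurFunction, kostka_rowFinsupp_self] at h
    simp only [Nat.cast_one, smul_eq_mul, mul_one] at h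
    exact Finsupp.mem_support_iff.1 hμ h
  · intro ν hν hne
    rw [map_smul, coeff_schurFunction, kostka_eq_zero_of_weightSum_le (hmin ν hν) hne.symm]
    simp

/-- By triangularity $h_\lambda$ is $s_\lambda$ plus Schur functions of smaller `weightSum`, and the
system is solved by strong induction. -/
theorem schurFunction_mem_span_completeSymmProd (lam : YoungDiagram) :
    schurFunction lam ∈ Submodule.span ℤ (Set.range completeSymmProd) := by
  classical
  induction h : weightSum lam.rowFinsupp using Nat.strong_induction_on generalizing lam with
  | _ n ih =>
    have h1 := completeSymmProd_eq_sum lam.rowFinsupp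
    rw [degree_rowFinsupp, ← Finset.add_sum_erase _ _ (mem_ofCard.2 rfl),
      kostka_rowFinsupp_self, Nat.cast_one, one_smul, ← sub_eq_iff_eq_add] at h1
    rw [← h1]
    refine Submodule.sub_mem _ (Submodule.subset_span ⟨_, rfl⟩) (Submodule.sum_mem _ ?_)
    intro ν hν
    by_cases hw : weightSum lam.rowFinsupp ≤ weightSum ν.rowFinsupp
    · rw [kostka_eq_zero_of_weightSum_le hw (Finset.ne_of_mem_erase hν).symm]
      simp
    · exact Submodule.smul_mem _ _ (ih _ (by omega) ν rfl)

theorem completeSymm_mul_mem (k : ℕ) {x : MvPowerSeries ℕ ℤ}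
    (hx : x ∈ Submodule.span ℤ (Set.range schurFunction)) :
    completeSymm k * x ∈ Submodule.span ℤ (Set.range schurFunction) := by
  classical
  induction hx using Submodule.span_induction with
  | mem x h =>
    obtain ⟨μ, rfl⟩ := h
    rw [completeSymm_mul_schurFunction]
    exact Submodule.sum_mem _ fun lam _ => Submodule.subset_span ⟨_, rfl⟩
  | zero => rw [mul_zero]; exact Submodule.zero_mem _
  | add x y _ _ hx hy => rw [mul_add]; exact Submodule.add_mem _ hx hy
  | smul a x _ hx => rw [mul_smul_comm]; exact Submodule.smul_mem _ _ hx

theorem completeSymmProd_mul_mem (α : ℕ →₀ ℕ) {x : MvPowerSeries ℕ ℤ}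
    (hx : x ∈ Submodule.span ℤ (Set.range schurFunction)) :
    completeSymmProd α * x ∈ Submodule.span ℤ (Set.range schurFunction) := by
  induction α using Finsupp.induction_on_max with
  | zero => rwa [completeSymmProd, Finsupp.prod_zero_index, one_mul]
  | single_add N g β hβ _ ih =>
    rw [completeSymmProd_single_add hβ, mul_assoc]
    exact completeSymm_mul_mem _ ih

/-- One factor is written in products of the $h_k$; multiplication by each $h_k$ preserves the span
of the Schur functions by Pieri's rule. -/
theorem schurFunction_mul_mem (μ ν : YoungDiagram) :
    schurFunction μ * schurFunction ν ∈ Submodule.span ℤ (Set.range schurFunction) := by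
  have h := schurFunction_mem_span_completeSymmProd μ
  generalize schurFunction μ = x at h
  induction h using Submodule.span_induction with
  | mem x h =>
    obtain ⟨α, rfl⟩ := h
    exact completeSymmProd_mul_mem α (Submodule.subset_span ⟨_, rfl⟩)
  | zero => rw [zero_mul]; exact Submodule.zero_mem _
  | add x y _ _ hx hy => rw [add_mul]; exact Submodule.add_mem _ hx hy
  | smul a x _ hx => rw [smul_mul_assoc]; exact Submodule.smul_mem _ _ hx

theorem existsUnique_isSchurExpansion (μ ν : YoungDiagram) :
    ∃! f : YoungDiagram →₀ ℤ, IsSchurExpansion μ ν f := by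
  obtain ⟨f, hf⟩ := Finsupp.mem_span_range_iff_exists_finsupp.1 (schurFunction_mul_mem μ ν)
  refine ⟨f, hf.symm, fun g hg => ?_⟩
  refine linearIndependent_schurFunction ?_
  rw [Finsupp.linearCombination_apply, Finsupp.linearCombination_apply, hf]
  exact hg.symm

/-! ### The sum of squares of Littlewood–Richardson coefficients as a trace -/

/-- The multiset of the nonzero values of a finitely supported function. -/
noncomputable def valueMultiset (α : ℕ →₀ ℕ) : Multiset ℕ := α.support.val.map α

theorem pos_of_mem_valueMultiset {α : ℕ →₀ ℕ} {x : ℕ} (h : x ∈ valueMultiset α) : 0 < x := by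
  obtain ⟨i, hi, rfl⟩ := Multiset.mem_map.1 h
  exact Nat.pos_of_ne_zero (Finsupp.mem_support_iff.1 hi)

theorem sum_valueMultiset (α : ℕ →₀ ℕ) : (valueMultiset α).sum = α.degree := rfl

theorem card_valueMultiset (α : ℕ →₀ ℕ) : (valueMultiset α).card = α.support.card := by
  simp [valueMultiset]

theorem completeSymmProd_eq (α : ℕ →₀ ℕ) :
    completeSymmProd α = ((valueMultiset α).map completeSymm).prod := by
  rw [valueMultiset, Multiset.map_map]
  rfl

theorem valueMultiset_rowFinsupp (μ : YoungDiagram) :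
    valueMultiset μ.rowFinsupp = (μ.rowLens : Multiset ℕ) := by
  have : μ.rowFinsupp.support = Finset.range (μ.colLen 0) := by
    ext i
    rw [Finsupp.mem_support_iff, rowFinsupp_apply, Finset.mem_range, ← mem_iff_lt_colLen,
      mem_iff_lt_rowLen, Nat.pos_iff_ne_zero]
  rw [valueMultiset, this]
  rfl

theorem valueMultiset_rowFinsupp_injective :
    Function.Injective fun μ : YoungDiagram => valueMultiset μ.rowFinsupp := by
  intro μ ν h
  simp only [valueMultiset_rowFinsupp, Multiset.coe_eq_coe] at h
  have h' : μ.rowLens = ν.rowLens :=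
    h.eq_of_pairwise' μ.rowLens_sorted.pairwise ν.rowLens_sorted.pairwise
  exact equivListRowLens.injective (Subtype.ext h')

theorem exists_valueMultiset_eq (M : Multiset ℕ) (hM : ∀ x ∈ M, 0 < x) :
    ∃ μ : YoungDiagram, valueMultiset μ.rowFinsupp = M := by
  have hs : (M.sort (· ≥ ·)).SortedGE := (M.pairwise_sort (· ≥ ·)).sortedGE
  refine ⟨ofRowLens (M.sort (· ≥ ·)) hs, ?_⟩
  rw [valueMultiset_rowFinsupp, rowLens_ofRowLens_eq_self, Multiset.sort_eq]
  intro x hx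
  exact hM x ((Multiset.mem_sort _).1 hx)

theorem sum_ofCard_eq_sum_partition {M : Type*} [AddCommMonoid M] (n : ℕ) (F : Multiset ℕ → M) :
    ∑ μ ∈ ofCard n, F (valueMultiset μ.rowFinsupp) = ∑ p : n.Partition, F p.parts := by
  refine Finset.sum_bij (fun μ hμ => ⟨valueMultiset μ.rowFinsupp, pos_of_mem_valueMultiset, by
    rw [sum_valueMultiset, degree_rowFinsupp, mem_ofCard.1 hμ]⟩) ?_ ?_ ?_ ?_
  · intros; exact Finset.mem_univ _
  · intro μ _ ν _ h
    exact valueMultiset_rowFinsupp_injective (congrArg Nat.Partition.parts h)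
  · intro p _
    obtain ⟨μ, hμ⟩ := exists_valueMultiset_eq p.parts fun x hx => p.parts_pos hx
    refine ⟨μ, ?_, Nat.Partition.ext hμ⟩
    rw [mem_ofCard, ← degree_rowFinsupp, ← sum_valueMultiset, hμ, p.parts_sum]
  · intros; rfl

theorem isSchurExpansion_epsilon (μ ν : YoungDiagram) :
    IsSchurExpansion μ ν (Classical.epsilon (IsSchurExpansion μ ν)) :=
  Classical.epsilon_spec (existsUnique_isSchurExpansion μ ν).exists

/-- The product is homogeneous, so discarding the terms of the wrong degree leaves another valid
expansion. Uniqueness identifies the two. -/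
theorem lrCoeff_eq_zero {lam μ ν : YoungDiagram} (h : lam.card ≠ μ.card + ν.card) :
    lrCoeff lam μ ν = 0 := by
  classical
  set f := Classical.epsilon (IsSchurExpansion μ ν) with hf
  have hfe : IsSchurExpansion μ ν f := isSchurExpansion_epsilon μ ν
  have hg : IsSchurExpansion μ ν (f.filter fun lam => lam.card = μ.card + ν.card) := by
    rw [IsSchurExpansion] at hfe ⊢
    ext γ
    rw [Finsupp.sum_filter_index, map_sum]
    by_cases hγ : γ.degree = μ.card + ν.card
    · rw [hfe, Finsupp.sum, map_sum, Finsupp.support_filter, Finset.sum_filter]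
      refine Finset.sum_congr rfl fun lam _ => ?_
      split_ifs with hl
      · rfl
      · rw [map_smul, coeff_schurFunction, kostka_eq_zero_of_degree_ne (by omega)]
        simp
    · rw [MvPowerSeries.coeff_mul, Finset.sum_eq_zero, Finset.sum_eq_zero]
      · intro lam hlam
        rw [Finsupp.support_filter, Finset.mem_filter] at hlam
        rw [map_smul, coeff_schurFunction, kostka_eq_zero_of_degree_ne (by omega)]
        simp
      · intro p hp
        have := congrArg Finsupp.degree (Finset.HasAntidiagonal.mem_antidiagonal.1 hp)
        rw [map_add] at this
        simp only [coeff_schurFunction]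
        by_cases h1 : p.1.degree = μ.card
        · rw [kostka_eq_zero_of_degree_ne (μ := ν) (by omega), Nat.cast_zero, mul_zero]
        · rw [kostka_eq_zero_of_degree_ne h1, Nat.cast_zero, zero_mul]
  have := (existsUnique_isSchurExpansion μ ν).unique hfe hg
  rw [lrCoeff, ← hf, this, Finsupp.filter_apply, if_neg h]

theorem schurFunction_mul_eq_sum (μ ν : YoungDiagram) {n : ℕ} (hn : μ.card + ν.card = n) :
    schurFunction μ * schurFunction ν =
      ∑ lam ∈ ofCard n, lrCoeff lam μ ν • schurFunction lam := by
  have h := isSchurExpansion_epsilon μ ν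
  rw [IsSchurExpansion, Finsupp.sum_of_support_subset (s := ofCard n)] at h
  · exact h
  · intro lam hlam
    rw [mem_ofCard]
    by_contra h'
    exact Finsupp.mem_support_iff.1 hlam (lrCoeff_eq_zero (by omega))
  · intros
    rw [zero_smul]

/-- The diagrams with at most `n` cells. -/
noncomputable def YoungDiagram.ofCardLE (n : ℕ) : Finset YoungDiagram :=
  ((Finset.range (n + 1)).finite_toSet.biUnion fun n _ => finite_card_eq n).toFinset

@[simp] theorem YoungDiagram.mem_ofCardLE {n : ℕ} {μ : YoungDiagram} :
    μ ∈ ofCardLE n ↔ μ.card ≤ n := by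
  simp [ofCardLE]

theorem completeSymmProd_eq_sum_ofCardLE {n : ℕ} {α : ℕ →₀ ℕ} (h : α.degree ≤ n) :
    completeSymmProd α = ∑ lam ∈ ofCardLE n, (kostka lam α : ℤ) • schurFunction lam := by
  rw [completeSymmProd_eq_sum]
  refine Finset.sum_subset (fun lam hl => ?_) fun lam _ hl => ?_
  · rw [mem_ofCard] at hl
    rw [mem_ofCardLE]
    omega
  · rw [mem_ofCard] at hl
    rw [kostka_eq_zero_of_degree_ne fun h => hl h.symm, Nat.cast_zero, zero_smul]

/-- The pairs of diagrams with `n` cells in total. -/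
noncomputable def YoungDiagram.pairsOfCard (n : ℕ) : Finset (YoungDiagram × YoungDiagram) :=
  (ofCardLE n ×ˢ ofCardLE n).filter fun p => p.1.card + p.2.card = n

/-- Comultiplication followed by multiplication, on a product of complete symmetric functions. -/
theorem sum_kostka_smul_lrCoeff_smul (α : ℕ →₀ ℕ) :
    ∑ lam ∈ ofCard α.degree, (kostka lam α : ℤ) • ∑ p ∈ pairsOfCard α.degree,
        lrCoeff lam p.1 p.2 • (schurFunction p.1 * schurFunction p.2) =
      ∑ b ∈ Finset.HasAntidiagonal.antidiagonal α,
        completeSymmProd b.1 * completeSymmProd b.2 := by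
  -- The coefficient of $x^\alpha$ in $s_\mu s_\nu$ is computed twice: from the Schur expansion, and
  -- as a convolution of Kostka numbers over $\beta+\gamma=\alpha$.
  have h1 : ∀ p ∈ pairsOfCard α.degree, ∑ lam ∈ ofCard α.degree, (kostka lam α : ℤ) •
      lrCoeff lam p.1 p.2 • (schurFunction p.1 * schurFunction p.2) =
      ∑ b ∈ Finset.HasAntidiagonal.antidiagonal α,
        ((kostka p.1 b.1 : ℤ) • schurFunction p.1) *
          ((kostka p.2 b.2 : ℤ) • schurFunction p.2) := by
    intro p hp
    have hp' := (Finset.mem_filter.1 hp).2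
    have hc := congrArg (MvPowerSeries.coeff α) (schurFunction_mul_eq_sum p.1 p.2 hp')
    rw [MvPowerSeries.coeff_mul, map_sum] at hc
    simp only [coeff_schurFunction] at hc
    simp_rw [smul_smul, smul_mul_smul_comm, ← Finset.sum_smul]
    rw [hc]
    congr 1
    exact Finset.sum_congr rfl fun _ _ => mul_comm _ _
  simp_rw [Finset.smul_sum]
  rw [Finset.sum_comm, Finset.sum_congr rfl h1, Finset.sum_comm]
  refine Finset.sum_congr rfl fun b hb => ?_
  have hd := congrArg Finsupp.degree (Finset.HasAntidiagonal.mem_antidiagonal.1 hb)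
  rw [map_add] at hd
  rw [completeSymmProd_eq_sum_ofCardLE (n := α.degree) (α := b.1) (by omega),
    completeSymmProd_eq_sum_ofCardLE (n := α.degree) (α := b.2) (by omega),
    Finset.sum_mul_sum, ← Finset.sum_product']
  refine Finset.sum_subset (Finset.filter_subset _ _) fun p hp hp' => ?_
  rw [pairsOfCard, Finset.mem_filter, not_and] at hp'
  have := hp' hp
  by_cases h1 : b.1.degree = p.1.card
  · rw [kostka_eq_zero_of_degree_ne (μ := p.2) (by omega), Nat.cast_zero, zero_smul, mul_zero]
  · rw [kostka_eq_zero_of_degree_ne h1, Nat.cast_zero, zero_smul, zero_mul]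

/-- The diagram whose rows are the nonzero exponents of `b.1` and `b.2`. -/
theorem exists_union_diagram (b : (ℕ →₀ ℕ) × (ℕ →₀ ℕ)) : ∃ μ : YoungDiagram,
    valueMultiset μ.rowFinsupp = valueMultiset b.1 + valueMultiset b.2 :=
  exists_valueMultiset_eq _ fun _ hx => (Multiset.mem_add.1 hx).elim
    pos_of_mem_valueMultiset pos_of_mem_valueMultiset

/-- Equality of the multisets forces equally many nonzero values, that is, the two supports have no
overlap. -/
theorem disjoint_support_iff {β γ : ℕ →₀ ℕ} :
    valueMultiset β + valueMultiset γ = valueMultiset (β + γ) ↔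
      Disjoint β.support γ.support := by
  classical
  constructor
  · intro h
    have hc := congrArg Multiset.card h
    rw [Multiset.card_add, card_valueMultiset, card_valueMultiset, card_valueMultiset] at hc
    have h2 : (β + γ).support = β.support ∪ γ.support := by
      ext i
      simp only [Finsupp.mem_support_iff, Finsupp.add_apply, Finset.mem_union]
      omega
    rw [h2] at hc
    have := Finset.card_union_add_card_inter β.support γ.support
    rw [Finset.disjoint_iff_inter_eq_empty, ← Finset.card_eq_zero]
    omega
  · intro h
    rw [valueMultiset, valueMultiset, valueMultiset, Finsupp.support_add_eq h,
      ← Finset.disjUnion_eq_union _ _ h, Finset.disjUnion_val, Multiset.map_add]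
    congr 1
    · refine Multiset.map_congr rfl fun i hi => ?_
      have := Finsupp.notMem_support_iff.1 (Finset.disjoint_left.1 h hi)
      rw [Finsupp.add_apply, this, add_zero]
    · refine Multiset.map_congr rfl fun i hi => ?_
      have := Finsupp.notMem_support_iff.1 (Finset.disjoint_right.1 h hi)
      rw [Finsupp.add_apply, this, zero_add]

/-- A splitting that keeps the multiset of parts sends each nonzero value of $\alpha$ wholly to one
side, so it is a subset of the support. -/
theorem card_antidiagonal_disjoint (α : ℕ →₀ ℕ) :
    ((Finset.HasAntidiagonal.antidiagonal α).filter fun b =>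
      valueMultiset b.1 + valueMultiset b.2 = valueMultiset α).card =
      2 ^ (valueMultiset α).card := by
  classical
  rw [card_valueMultiset, ← Finset.card_powerset]
  have key : ∀ b : (ℕ →₀ ℕ) × (ℕ →₀ ℕ), b ∈ (Finset.HasAntidiagonal.antidiagonal α).filter (fun b =>
      valueMultiset b.1 + valueMultiset b.2 = valueMultiset α) ↔
      b.1 + b.2 = α ∧ Disjoint b.1.support b.2.support := by
    intro b
    rw [Finset.mem_filter, Finset.HasAntidiagonal.mem_antidiagonal]
    refine and_congr_right fun h => ?_
    rw [← h, disjoint_support_iff]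
  refine Finset.card_bij' (fun b _ => b.1.support)
    (fun S _ => (α.filter (· ∈ S), α.filter (· ∉ S))) ?_ ?_ ?_ ?_
  · intro b hb
    rw [key] at hb
    rw [Finset.mem_powerset, ← hb.1, Finsupp.support_add_eq hb.2]
    exact Finset.subset_union_left
  · intro S _
    rw [key]
    refine ⟨Finsupp.filter_add_filter_not _ _, ?_⟩
    rw [Finsupp.support_filter, Finsupp.support_filter]
    exact Finset.disjoint_filter_filter_not _ _ _
  · intro b hb
    rw [key] at hb
    have h1 : ∀ i, i ∈ b.1.support → b.2 i = 0 := fun i hi =>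
      Finsupp.notMem_support_iff.1 (Finset.disjoint_left.1 hb.2 hi)
    refine Prod.ext (Finsupp.ext fun i => ?_) (Finsupp.ext fun i => ?_)
    · rw [Finsupp.filter_apply, ← hb.1, Finsupp.add_apply]
      split_ifs with h
      · rw [h1 i h, add_zero]
      · exact (Finsupp.notMem_support_iff.1 h).symm
    · rw [Finsupp.filter_apply, ← hb.1, Finsupp.add_apply]
      split_ifs with h
      · exact (h1 i h).symm
      · rw [Finsupp.notMem_support_iff.1 h, zero_add]
  · intro S hS
    rw [Finset.mem_powerset] at hS
    rw [Finsupp.support_filter]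
    ext i
    rw [Finset.mem_filter]
    exact ⟨fun h => h.2, fun h => ⟨hS h, h⟩⟩

/-- Similar matrices have the same trace. Here `M` is the operator in the Schur basis, `B` the
operator in the basis of the $h_\alpha$, and `A` the Kostka matrix that intertwines them. Rational
entries make `A` invertible as soon as it is injective. -/
theorem sum_sq_lrCoeff (n : ℕ) :
    ∑ lam ∈ ofCard n, ∑ p ∈ pairsOfCard n, lrCoeff lam p.1 p.2 ^ 2 =
      ∑ p : n.Partition, 2 ^ p.parts.card := by
  classical
  choose δ hδ using exists_union_diagram
  let A : Matrix (ofCard n) (ofCard n) ℚ := fun α lam => kostka lam.1 α.1.rowFinsupp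
  let M : Matrix (ofCard n) (ofCard n) ℚ := fun lam κ =>
    ((∑ p ∈ pairsOfCard n, lrCoeff lam.1 p.1 p.2 * lrCoeff κ.1 p.1 p.2 : ℤ) : ℚ)
  let B : Matrix (ofCard n) (ofCard n) ℚ := fun α d =>
    (((Finset.HasAntidiagonal.antidiagonal α.1.rowFinsupp).filter fun b => δ b = d.1).card : ℚ)
  have hdeg : ∀ α ∈ ofCard n, α.rowFinsupp.degree = n := fun α hα => by
    rw [degree_rowFinsupp, mem_ofCard.1 hα]
  have hδn : ∀ α ∈ ofCard n, ∀ b ∈ Finset.HasAntidiagonal.antidiagonal α.rowFinsupp,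
      δ b ∈ ofCard n := by
    intro α hα b hb
    rw [mem_ofCard, ← degree_rowFinsupp, ← sum_valueMultiset, hδ, Multiset.sum_add,
      sum_valueMultiset, sum_valueMultiset, ← map_add,
      Finset.HasAntidiagonal.mem_antidiagonal.1 hb, hdeg α hα]
  -- The image of $h_\alpha$ is expanded in Schur functions along two routes, and linear
  -- independence equates the coefficients.
  have hZ : ∀ α ∈ ofCard n, ∀ κ ∈ ofCard n,
      ∑ lam ∈ ofCard n, (kostka lam α.rowFinsupp : ℤ) *
        ∑ p ∈ pairsOfCard n, lrCoeff lam p.1 p.2 * lrCoeff κ p.1 p.2 =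
      ∑ d ∈ ofCard n, (((Finset.HasAntidiagonal.antidiagonal α.rowFinsupp).filter
        fun b => δ b = d).card : ℤ) * kostka κ d.rowFinsupp := by
    intro α hα
    refine linearIndependent_iff'ₛ.1 linearIndependent_schurFunction _ _ _ ?_
    have h := sum_kostka_smul_lrCoeff_smul α.rowFinsupp
    rw [hdeg α hα] at h
    have hl : ∀ lam ∈ ofCard n, ∑ p ∈ pairsOfCard n,
        lrCoeff lam p.1 p.2 • (schurFunction p.1 * schurFunction p.2) =
        ∑ κ ∈ ofCard n, (∑ p ∈ pairsOfCard n, lrCoeff lam p.1 p.2 * lrCoeff κ p.1 p.2) •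
          schurFunction κ := by
      intro lam _
      simp_rw [Finset.sum_smul]
      rw [Finset.sum_comm]
      refine Finset.sum_congr rfl fun p hp => ?_
      rw [schurFunction_mul_eq_sum p.1 p.2 (Finset.mem_filter.1 hp).2, Finset.smul_sum]
      simp_rw [smul_smul]
    have hr : ∀ b ∈ Finset.HasAntidiagonal.antidiagonal α.rowFinsupp,
        completeSymmProd b.1 * completeSymmProd b.2 =
          ∑ κ ∈ ofCard n, (kostka κ (δ b).rowFinsupp : ℤ) • schurFunction κ := by
      intro b hb
      have h2 := completeSymmProd_eq_sum (δ b).rowFinsupp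
      rw [hdeg _ (hδn α hα b hb)] at h2
      rw [← h2, completeSymmProd_eq, completeSymmProd_eq, completeSymmProd_eq, hδ,
        Multiset.map_add, Multiset.prod_add]
    rw [Finset.sum_congr rfl hr] at h
    simp_rw [Finset.sum_smul, mul_smul]
    rw [Finset.sum_comm]
    simp_rw [← Finset.smul_sum]
    rw [Finset.sum_congr rfl fun lam hlam => by rw [← hl lam hlam], h]
    conv_rhs => rw [Finset.sum_comm]
    rw [← Finset.sum_fiberwise_of_maps_to (hδn α hα)]
    refine Finset.sum_congr rfl fun d _ => ?_
    rw [← Finset.smul_sum, Finset.sum_congr rfl (g := fun _ =>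
      ∑ κ ∈ ofCard n, (kostka κ d.rowFinsupp : ℤ) • schurFunction κ), Finset.sum_const]
    · simp
    · intro b hb
      rw [(Finset.mem_filter.1 hb).2]
  have hAM : A * M = B * A := by
    ext α κ
    have := congrArg (Int.cast : ℤ → ℚ) (hZ α.1 α.2 κ.1 κ.2)
    rw [Matrix.mul_apply, Matrix.mul_apply]
    rw [← Finset.sum_coe_sort (ofCard n), ← Finset.sum_coe_sort (ofCard n)] at this
    simpa [A, M, B] using this
  -- If $x\ne0$, the coordinate of $Ax$ at an index of least `weightSum` in the support of $x$
  -- equals that coordinate of $x$.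
  have hA : IsUnit A := by
    rw [← Matrix.mulVec_injective_iff_isUnit, ← Matrix.coe_mulVecLin, injective_iff_map_eq_zero]
    intro x hx
    by_contra hne
    obtain ⟨μ, hμ, hmin⟩ := Finset.exists_min_image (Finset.univ.filter fun μ => x μ ≠ 0)
      (fun ν => weightSum ν.1.rowFinsupp) (by
        obtain ⟨i, hi⟩ := Function.ne_iff.1 hne
        exact ⟨i, by simpa using hi⟩)
    have h := congrFun hx μ
    rw [Matrix.mulVecLin_apply, Matrix.mulVec, dotProduct,
      Finset.sum_eq_single_of_mem μ (Finset.mem_univ _)] at h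
    · simp only [A, kostka_rowFinsupp_self, Nat.cast_one, one_mul, Pi.zero_apply] at h
      exact (Finset.mem_filter.1 hμ).2 h
    · intro ν _ hνμ
      by_cases hν : x ν = 0
      · rw [hν, mul_zero]
      · simp only [A]
        rw [kostka_eq_zero_of_weightSum_le
          (hmin ν (Finset.mem_filter.2 ⟨Finset.mem_univ _, hν⟩)) fun h => hνμ (Subtype.ext h.symm),
          Nat.cast_zero, zero_mul]
  have htr : M.trace = B.trace := by
    rw [← Matrix.trace_conj hA M, hAM, Matrix.mul_assoc, Matrix.mul_nonsing_inv, Matrix.mul_one]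
    exact (Matrix.isUnit_iff_isUnit_det A).1 hA
  have hM : M.trace =
      ((∑ lam ∈ ofCard n, ∑ p ∈ pairsOfCard n, lrCoeff lam p.1 p.2 ^ 2 : ℤ) : ℚ) := by
    rw [Matrix.trace, ← Finset.sum_coe_sort (ofCard n)]
    simp [M, sq, Matrix.diag]
  have hB : B.trace = ((∑ p : n.Partition, 2 ^ p.parts.card : ℤ) : ℚ) := by
    rw [← sum_ofCard_eq_sum_partition n fun m => (2 : ℤ) ^ m.card, Matrix.trace,
      ← Finset.sum_coe_sort (ofCard n), Int.cast_sum]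
    refine Finset.sum_congr rfl fun α _ => ?_
    simp only [B, Matrix.diag]
    rw [← Nat.cast_ofNat, ← Nat.cast_pow, ← card_antidiagonal_disjoint, Int.cast_natCast]
    congr 2
    refine Finset.filter_congr fun b _ => ?_
    rw [← hδ]
    exact ⟨fun h => by rw [h], fun h => valueMultiset_rowFinsupp_injective h⟩
  exact_mod_cast hM.symm.trans (htr.trans hB)

/-! ### The infinite product as a partition generating function -/

theorem one_add_tsum_eq_inv (k : ℕ) :
    1 + ∑' j : ℕ, ((2 : ℚ) ^ (j + 1)) • (PowerSeries.X : PowerSeries ℚ) ^ ((k + 1) * (j + 1)) =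
      (1 - 2 * (PowerSeries.X : PowerSeries ℚ) ^ (k + 1))⁻¹ := by
  set f : PowerSeries ℚ := 2 * PowerSeries.X ^ (k + 1) with hf
  have hf0 : f.constantCoeff = 0 := by simp [hf]
  have key := PowerSeries.WithPiTopology.tsum_pow_mul_one_sub_of_constantCoeff_eq_zero hf0
  rw [(PowerSeries.WithPiTopology.summable_pow_of_constantCoeff_eq_zero hf0).tsum_eq_zero_add,
    pow_zero] at key
  rw [PowerSeries.eq_inv_iff_mul_eq_one (by simp [hf0])]
  refine Eq.trans ?_ key
  congr 3
  ext1 j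
  rw [hf, mul_pow, ← pow_mul, PowerSeries.smul_eq_C_mul, map_pow]
  rfl

theorem hasProd_stable :
    HasProd (fun k : ℕ => (1 - 2 * (PowerSeries.X : PowerSeries ℚ) ^ (k + 1))⁻¹)
      (Nat.Partition.genFun fun _ c => (2 : ℚ) ^ c) := by
  have h := Nat.Partition.hasProd_genFun (R := ℚ) fun _ c => (2 : ℚ) ^ c
  simp only [one_add_tsum_eq_inv] at h
  exact h

/-- A part of multiplicity $c$ contributes $2^c$ from the geometric series of its factor, and the
multiplicities add up to the number of parts. -/
theorem coeff_stableProduct (d : ℕ) :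
    PowerSeries.coeff d stableProduct = ∑ p : d.Partition, (2 : ℚ) ^ p.parts.card := by
  rw [stableProduct, hasProd_stable.tprod_eq, Nat.Partition.coeff_genFun]
  refine Finset.sum_congr rfl fun p _ => ?_
  rw [Finsupp.prod, Finset.prod_pow_eq_pow_sum, Multiset.toFinsupp_support]
  simp only [Multiset.toFinsupp_apply, Multiset.toFinset_sum_count_eq]

theorem hasSum_sq_lrCoeff :
    HasSum (fun τ : YoungDiagram × YoungDiagram × YoungDiagram =>
        PowerSeries.C ((lrCoeff τ.1 τ.2.1 τ.2.2 : ℚ) ^ 2) * PowerSeries.X ^ τ.1.card)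
      stableProduct := by
  rw [PowerSeries.WithPiTopology.hasSum_iff_hasSum_coeff]
  intro d
  have hsum : PowerSeries.coeff d stableProduct = ∑ τ ∈ ofCard d ×ˢ pairsOfCard d,
      PowerSeries.coeff d (PowerSeries.C ((lrCoeff τ.1 τ.2.1 τ.2.2 : ℚ) ^ 2) *
        PowerSeries.X ^ τ.1.card) := by
    have h := congrArg (Int.cast : ℤ → ℚ) (sum_sq_lrCoeff d)
    push_cast at h
    rw [coeff_stableProduct, ← h, ← Finset.sum_product']
    refine Finset.sum_congr rfl fun τ hτ => ?_
    rw [PowerSeries.coeff_C_mul, PowerSeries.coeff_X_pow,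
      if_pos (mem_ofCard.1 (Finset.mem_product.1 hτ).1).symm, mul_one]
  rw [hsum]
  refine hasSum_sum_of_ne_finset_zero fun τ hτ => ?_
  rw [PowerSeries.coeff_C_mul, PowerSeries.coeff_X_pow]
  by_cases hd : d = τ.1.card
  · rw [lrCoeff_eq_zero, Int.cast_zero, zero_pow two_ne_zero, zero_mul]
    intro h
    refine hτ (Finset.mem_product.2 ⟨mem_ofCard.2 hd.symm, Finset.mem_filter.2
      ⟨Finset.mem_product.2 ⟨mem_ofCardLE.2 ?_, mem_ofCardLE.2 ?_⟩, ?_⟩⟩) <;> omega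
  · rw [if_neg hd, mul_zero]

end SchurFunctions

/-! ### Counting labelled permutations up to conjugation -/

section Invariants

open Equiv

/-- A permutation of `α` together with a labelling of `α` by `L`. -/
@[ext] structure LabelledPerm (L α : Type) where
  /-- the labelling -/
  label : α → L
  /-- the permutation -/
  perm : Perm α

instance LabelledPerm.finite (L α : Type) [Finite L] [Finite α] : Finite (LabelledPerm L α) :=
  Finite.of_injective (β := (α → L) × Perm α) (fun p => (p.label, p.perm)) fun _ _ h =>
    LabelledPerm.ext (Prod.ext_iff.1 h).1 (Prod.ext_iff.1 h).2

/-- Permutations act by relabelling and conjugation. -/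
instance (L α : Type) : MulAction (Perm α) (LabelledPerm L α) where
  smul τ p := ⟨p.label ∘ τ.symm, τ * p.perm * τ⁻¹⟩
  one_smul p := LabelledPerm.ext rfl (by change 1 * p.perm * 1⁻¹ = p.perm; simp)
  mul_smul τ τ' p := LabelledPerm.ext rfl (by
    change τ * τ' * p.perm * (τ * τ')⁻¹ = τ * (τ' * p.perm * τ'⁻¹) * τ⁻¹
    group)

theorem LabelledPerm.smul_def {L α : Type} (τ : Perm α) (p : LabelledPerm L α) :
    τ • p = ⟨p.label ∘ τ.symm, τ * p.perm * τ⁻¹⟩ := rfl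

section LabelledPerm

variable {α : Type} [Fintype α] [DecidableEq α]

/-- The cycle of `τ` through `x`, or the fixed point `x`. -/
def cycleOrFixedPoint (τ : Perm α) (x : α) : τ.cycleFactorsFinset ⊕ {x // x ∉ τ.support} :=
  if h : x ∈ τ.support then Sum.inl ⟨τ.cycleOf x, Perm.cycleOf_mem_cycleFactorsFinset_iff.2 h⟩
  else Sum.inr ⟨x, h⟩

theorem cycleOrFixedPoint_surjective (τ : Perm α) :
    Function.Surjective (cycleOrFixedPoint τ) := by
  rintro (⟨c, hc⟩ | ⟨x, hx⟩)
  · obtain ⟨x, hx⟩ := (Perm.mem_cycleFactorsFinset_iff.1 hc).1.nonempty_support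
    refine ⟨x, ?_⟩
    rw [cycleOrFixedPoint, dif_pos (Perm.mem_cycleFactorsFinset_support_le hc hx)]
    exact congrArg Sum.inl (Subtype.ext (Perm.cycle_is_cycleOf hx hc).symm)
  · exact ⟨x, by rw [cycleOrFixedPoint, dif_neg hx]⟩

theorem sameCycle_of_cycleOrFixedPoint_eq {τ : Perm α} {x y : α}
    (h : cycleOrFixedPoint τ x = cycleOrFixedPoint τ y) : τ.SameCycle x y := by
  rw [cycleOrFixedPoint, cycleOrFixedPoint] at h
  split_ifs at h with hx hy
  · have h1 : τ.cycleOf x = τ.cycleOf y := congrArg Subtype.val (Sum.inl_injective h)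
    have h2 : y ∈ (τ.cycleOf y).support := by
      rw [Perm.mem_support_cycleOf_iff]
      exact ⟨Perm.SameCycle.refl _ _, hy⟩
    rw [← h1, Perm.mem_support_cycleOf_iff] at h2
    exact h2.1
  · have h1 : x = y := congrArg Subtype.val (Sum.inr_injective h)
    rw [h1]

theorem cycleOrFixedPoint_apply (τ : Perm α) (x : α) :
    cycleOrFixedPoint τ (τ x) = cycleOrFixedPoint τ x := by
  by_cases hx : x ∈ τ.support
  · rw [cycleOrFixedPoint, cycleOrFixedPoint, dif_pos hx, dif_pos (Perm.apply_mem_support.2 hx)]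
    exact congrArg Sum.inl (Subtype.ext (Perm.cycleOf_self_apply τ x))
  · rw [Perm.notMem_support.1 hx]

theorem card_cycles_add_card_fixedPoints (τ : Perm α) :
    Nat.card (τ.cycleFactorsFinset ⊕ {x // x ∉ τ.support}) = τ.partition.parts.card := by
  rw [Nat.card_sum, Perm.parts_partition, Multiset.card_add, Multiset.card_replicate,
    Perm.cycleType_def, Multiset.card_map, Nat.card_eq_fintype_card, Fintype.card_coe,
    Nat.card_eq_fintype_card, Fintype.card_subtype_compl, Fintype.card_coe]
  rfl

/-- An invariant labelling is a free choice of one label per cycle, fixed points included. -/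
theorem card_invariant_labellings (L : Type) [Finite L] (τ : Perm α) :
    Nat.card {a : α → L // ∀ x, a (τ x) = a x} = Nat.card L ^ τ.partition.parts.card := by
  rw [← card_cycles_add_card_fixedPoints, ← Nat.card_fun]
  refine (Nat.card_congr (Equiv.ofBijective (fun b => ⟨b ∘ cycleOrFixedPoint τ, fun x => by
    simp only [Function.comp_apply, cycleOrFixedPoint_apply]⟩) ⟨?_, ?_⟩)).symm
  · intro b b' h
    exact (cycleOrFixedPoint_surjective τ).injective_comp_right (congrArg Subtype.val h)
  · rintro ⟨a, ha⟩
    have hpow : ∀ (n : ℕ) (x : α), a ((τ ^ n) x) = a x := by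
      intro n
      induction n with
      | zero => intro x; rfl
      | succ n ih => intro x; rw [pow_succ', Perm.mul_apply, ha, ih]
    refine ⟨a ∘ Function.surjInv (cycleOrFixedPoint_surjective τ), Subtype.ext (funext fun x => ?_)⟩
    obtain ⟨n, -, hn⟩ := (sameCycle_of_cycleOrFixedPoint_eq
      (Function.surjInv_eq (cycleOrFixedPoint_surjective τ) (cycleOrFixedPoint τ x))).exists_pow_eq'
    simp only [Function.comp_apply]
    exact (hpow n _).symm.trans (congrArg a hn)

/-- The cycle type omits fixed points, so the parts equal to 1 are split off and restored by
counting. -/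
theorem exists_perm_partition_eq (p : (Fintype.card α).Partition) :
    ∃ τ : Perm α, τ.partition = p := by
  have h0 := Multiset.filter_add_not (fun n => 2 ≤ n) p.parts
  have h1 : p.parts.filter (fun n => ¬ 2 ≤ n) =
      Multiset.replicate (p.parts.filter (fun n => ¬ 2 ≤ n)).card 1 := by
    rw [Multiset.eq_replicate]
    refine ⟨rfl, fun b hb => ?_⟩
    rw [Multiset.mem_filter] at hb
    have := p.parts_pos hb.1
    omega
  have hsum := congrArg Multiset.sum h0
  rw [p.parts_sum, Multiset.sum_add, h1, Multiset.sum_replicate, smul_eq_mul, mul_one] at hsum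
  obtain ⟨τ, hτ⟩ := (Perm.exists_with_cycleType_iff α (m := p.parts.filter fun n => 2 ≤ n)).2
    ⟨by omega, fun a ha => (Multiset.mem_filter.1 ha).2⟩
  refine ⟨τ, Nat.Partition.ext ?_⟩
  rw [Perm.parts_partition, ← Perm.sum_cycleType, hτ]
  conv_rhs => rw [← h0, h1]
  congr 2
  omega

theorem card_perm_partition_eq_mul (τ : Perm α) :
    (Finset.univ.filter fun σ : Perm α => σ.partition = τ.partition).card *
      Nat.card (Subgroup.centralizer {τ}) = (Fintype.card α).factorial := by
  rw [Perm.nat_card_centralizer, ← Perm.card_isConj_mul_eq τ]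
  congr 1
  rw [Set.coe_ofPred, Nat.card_eq_fintype_card, Fintype.card_subtype]
  congr 1
  ext σ
  simp only [Finset.mem_filter, Finset.mem_univ, true_and]
  rw [Perm.partition_eq_of_isConj, eq_comm]

/-- Class size times centralizer order is the group order, so each partition contributes $F(p)\cdot
d!$, where $d$ is the size of the set. -/
theorem sum_perm_card_centralizer_mul (F : (Fintype.card α).Partition → ℕ) :
    ∑ τ : Perm α, F τ.partition * Nat.card (Subgroup.centralizer {τ}) =
      (∑ p, F p) * (Fintype.card α).factorial := by
  rw [← Finset.sum_fiberwise_of_maps_to (t := Finset.univ) (g := Perm.partition)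
    (fun _ _ => Finset.mem_univ _), Finset.sum_mul]
  refine Finset.sum_congr rfl fun p _ => ?_
  obtain ⟨τ, rfl⟩ := exists_perm_partition_eq p
  rw [← card_perm_partition_eq_mul τ, Finset.sum_congr rfl (g := fun _ =>
    F τ.partition * Nat.card (Subgroup.centralizer {τ})), Finset.sum_const, smul_eq_mul]
  · ring
  · intro σ hσ
    have h := (Finset.mem_filter.1 hσ).2
    rw [h]
    congr 1
    have h1 := card_perm_partition_eq_mul σ
    rw [h, ← card_perm_partition_eq_mul τ] at h1
    exact Nat.eq_of_mul_eq_mul_left (Finset.card_pos.2 ⟨σ, hσ⟩) h1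

theorem card_fixedBy_labelledPerm (L : Type) [Finite L] (τ : Perm α) :
    Nat.card (MulAction.fixedBy (LabelledPerm L α) τ) =
      Nat.card L ^ τ.partition.parts.card * Nat.card (Subgroup.centralizer {τ}) := by
  rw [← card_invariant_labellings, ← Nat.card_prod]
  have key : ∀ p : LabelledPerm L α, τ • p = p ↔
      (∀ x, p.label (τ x) = p.label x) ∧ p.perm ∈ Subgroup.centralizer {τ} := by
    intro p
    rw [LabelledPerm.smul_def, LabelledPerm.ext_iff]
    refine and_congr ?_ ?_
    · constructor
      · intro h x
        have := congrFun h (τ x)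
        simpa using this.symm
      · intro h
        funext x
        have := h (τ.symm x)
        simpa using this.symm
    · rw [Subgroup.mem_centralizer_singleton_iff, mul_inv_eq_iff_eq_mul, eq_comm]
  exact Nat.card_congr
    { toFun := fun p => (⟨p.1.label, ((key p.1).1 p.2).1⟩, ⟨p.1.perm, ((key p.1).1 p.2).2⟩)
      invFun := fun q => ⟨⟨q.1.1, q.2.1⟩, (key _).2 ⟨q.1.2, q.2.2⟩⟩
      left_inv := fun _ => rfl
      right_inv := fun _ => rfl }

/-- Burnside's lemma: a permutation $\tau$ fixes a labelled permutation when the labels are constant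
on the cycles of $\tau$ and the permutation commutes with $\tau$. The centralizer factors absorb the
division by the group order. -/
theorem card_orbits_labelledPerm (L : Type) [Finite L] :
    Nat.card (MulAction.orbitRel.Quotient (Perm α) (LabelledPerm L α)) =
      ∑ p : (Fintype.card α).Partition, Nat.card L ^ p.parts.card := by
  classical
  have := Fintype.ofFinite (MulAction.orbitRel.Quotient (Perm α) (LabelledPerm L α))
  have := fun τ : Perm α => Fintype.ofFinite (MulAction.fixedBy (LabelledPerm L α) τ)
  have h := MulAction.sum_card_fixedBy_eq_card_orbits_mul_card_group (Perm α) (LabelledPerm L α)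
  simp_rw [← Nat.card_eq_fintype_card, card_fixedBy_labelledPerm] at h
  rw [sum_perm_card_centralizer_mul (fun p => Nat.card L ^ p.parts.card), Nat.card_perm,
    Nat.card_eq_fintype_card (α := α)] at h
  exact (Nat.eq_of_mul_eq_mul_right (Nat.factorial_pos _) h).symm

end LabelledPerm

/-! ### The symmetric algebra through symmetric tensors -/

section SymmetricTensors

variable {V B : Type} [AddCommGroup V] [Module ℂ V]

/-- The `d`-th tensor power of a matrix. -/
def tensorPow {m : Type} (A : Matrix m m ℂ) (d : ℕ) : Matrix (Fin d → m) (Fin d → m) ℂ :=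
  fun i j => ∏ k, A (i k) (j k)

/-- The projection from the tensors of degree `d`, in coordinates, to the symmetric algebra. -/
noncomputable def tensorToSym [Fintype B] (b : Module.Basis B ℂ V) (d : ℕ) :
    ((Fin d → B) → ℂ) →ₗ[ℂ] SymmetricAlgebra ℂ V :=
  Fintype.linearCombination ℂ fun f => ∏ k, SymmetricAlgebra.ι ℂ V (b (f k))

/-- The tensor `c`, in coordinates, is symmetric. -/
def IsSymmTensor {d : ℕ} (c : (Fin d → B) → ℂ) : Prop := ∀ (τ : Perm (Fin d)) f, c (f ∘ τ) = c f

theorem tensorToSym_apply [Fintype B] (b : Module.Basis B ℂ V) {d : ℕ} (c : (Fin d → B) → ℂ) :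
    tensorToSym b d c = ∑ f, c f • ∏ k, SymmetricAlgebra.ι ℂ V (b (f k)) := rfl

theorem exists_perm_of_sum_single_eq [DecidableEq B] {d : ℕ} {f g : Fin d → B}
    (h : ∑ k, Finsupp.single (f k) 1 = ∑ k, Finsupp.single (g k) 1) :
    ∃ τ : Perm (Fin d), f = g ∘ τ := by
  have hcount : ∀ x, Fintype.card {k // f k = x} = Fintype.card {k // g k = x} := by
    intro x
    have hx := DFunLike.congr_fun h x
    rw [Finsupp.finsetSum_apply, Finsupp.finsetSum_apply] at hx
    simpa [Finsupp.single_apply, Fintype.card_subtype] using hx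
  refine ⟨(Equiv.sigmaFiberEquiv f).symm.trans ((Equiv.sigmaCongrRight fun x =>
    Fintype.equivOfCardEq (hcount x)).trans (Equiv.sigmaFiberEquiv g)), funext fun k => ?_⟩
  exact ((Fintype.equivOfCardEq (hcount (f k))) ⟨k, rfl⟩).2.symm

/-- The coefficient of a monomial in the image is $c_g$ times the number of tuples that rearrange
$g$, a nonzero integer, and the characteristic is 0. -/
theorem eq_zero_of_tensorToSym_eq_zero [Fintype B] [DecidableEq B] (b : Module.Basis B ℂ V)
    {d : ℕ} {c : (Fin d → B) → ℂ} (hc : IsSymmTensor c) (h : tensorToSym b d c = 0) : c = 0 := by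
  funext g
  have h1 := congrArg (fun x => MvPolynomial.coeff (∑ k, Finsupp.single (g k) 1)
    (SymmetricAlgebra.equivMvPolynomial b x)) h
  simp only [tensorToSym_apply, map_sum, map_smul, map_prod, map_zero, MvPolynomial.coeff_zero,
    SymmetricAlgebra.equivMvPolynomial_ι_apply, MvPolynomial.coeff_sum,
    MvPolynomial.coeff_smul] at h1
  have hX : ∀ f : Fin d → B, ∏ k, (MvPolynomial.X (f k) : MvPolynomial B ℂ) =
      MvPolynomial.monomial (∑ k, Finsupp.single (f k) 1) 1 := by
    intro f
    rw [MvPolynomial.monomial_sum_one]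
    rfl
  simp only [hX, MvPolynomial.coeff_monomial] at h1
  have h2 : ∀ f : Fin d → B, c f • (if ∑ k, Finsupp.single (f k) 1 = ∑ k, Finsupp.single (g k) 1
      then (1 : ℂ) else 0) = (if ∑ k, Finsupp.single (f k) 1 = ∑ k, Finsupp.single (g k) 1
      then (1 : ℂ) else 0) * c g := by
    intro f
    split_ifs with hf
    · obtain ⟨τ, rfl⟩ := exists_perm_of_sum_single_eq hf
      rw [hc, smul_eq_mul, mul_comm]
    · simp
  rw [Finset.sum_congr rfl fun f _ => h2 f, ← Finset.sum_mul, Finset.sum_boole] at h1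
  refine (mul_eq_zero.1 h1).resolve_left (Nat.cast_ne_zero.2 (Finset.card_ne_zero.2 ⟨g, ?_⟩))
  simp

theorem range_tensorToSym [Fintype B] (b : Module.Basis B ℂ V) (d : ℕ) :
    LinearMap.range (tensorToSym b d) = LinearMap.range (SymmetricAlgebra.ι ℂ V) ^ d := by
  have hι : LinearMap.range (SymmetricAlgebra.ι ℂ V) =
      Submodule.span ℂ (Set.range fun x => SymmetricAlgebra.ι ℂ V (b x)) := by
    rw [LinearMap.range_eq_map, ← b.span_eq, Submodule.map_span, ← Set.range_comp]
    rfl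
  rw [tensorToSym, Fintype.range_linearCombination, hι, Submodule.span_pow]
  congr 1
  ext x
  rw [Set.mem_pow]
  constructor
  · rintro ⟨f, rfl⟩
    exact ⟨fun k => ⟨_, f k, rfl⟩, by rw [List.prod_ofFn]⟩
  · rintro ⟨f, rfl⟩
    choose g hg using fun k => (f k).2
    exact ⟨g, by rw [List.prod_ofFn]; exact Finset.prod_congr rfl fun k _ => hg k⟩

theorem tensorToSym_comp_perm [Fintype B] (b : Module.Basis B ℂ V) {d : ℕ} (c : (Fin d → B) → ℂ)
    (τ : Perm (Fin d)) : tensorToSym b d (fun f => c (f ∘ τ)) = tensorToSym b d c := by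
  rw [tensorToSym_apply, tensorToSym_apply]
  refine Fintype.sum_equiv (Equiv.arrowCongr τ.symm (Equiv.refl B)) _ _ fun f => ?_
  congr 1
  exact (Equiv.prod_comp τ fun k => SymmetricAlgebra.ι ℂ V (b (f k))).symm

theorem exists_symmTensor [Fintype B] (b : Module.Basis B ℂ V) {d : ℕ} {x : SymmetricAlgebra ℂ V}
    (hx : x ∈ LinearMap.range (SymmetricAlgebra.ι ℂ V) ^ d) :
    ∃ c, IsSymmTensor c ∧ tensorToSym b d c = x := by
  rw [← range_tensorToSym b] at hx
  obtain ⟨c, rfl⟩ := hx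
  -- Averaging over $S_d$ makes the tensor symmetric and leaves its image unchanged, since the
  -- symmetric algebra is commutative.
  refine ⟨(d.factorial : ℂ)⁻¹ • ∑ τ : Perm (Fin d), fun f => c (f ∘ τ), ?_, ?_⟩
  · intro σ f
    rw [Pi.smul_apply, Pi.smul_apply, Finset.sum_apply, Finset.sum_apply]
    congr 1
    exact Fintype.sum_equiv (Equiv.mulLeft σ) _ _ fun τ => rfl
  · rw [map_smul, map_sum, Finset.sum_congr rfl fun τ _ => tensorToSym_comp_perm b c τ,
      Finset.sum_const, Finset.card_univ, Fintype.card_perm, Fintype.card_fin,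
      ← Nat.cast_smul_eq_nsmul ℂ,
      smul_smul, inv_mul_cancel₀ (Nat.cast_ne_zero.2 (Nat.factorial_ne_zero d)), one_smul]

theorem isSymmTensor_tensorPow_mulVec [Fintype B] {d : ℕ} {c : (Fin d → B) → ℂ}
    (hc : IsSymmTensor c) (A : Matrix B B ℂ) : IsSymmTensor (Matrix.mulVec (tensorPow A d) c) := by
  intro τ f
  rw [Matrix.mulVec, Matrix.mulVec, dotProduct, dotProduct]
  refine Fintype.sum_equiv (Equiv.arrowCongr τ (Equiv.refl B)) _ _ fun g => ?_
  congr 1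
  · rw [tensorPow, tensorPow, ← Equiv.prod_comp τ fun k => A (f k) _]
    simp
  · exact (hc τ.symm g).symm

theorem symMap_tensorToSym [Fintype B] [DecidableEq B] (b : Module.Basis B ℂ V)
    {d : ℕ} (c : (Fin d → B) → ℂ) (φ : V →ₗ[ℂ] V) : symMap φ (tensorToSym b d c) =
      tensorToSym b d (Matrix.mulVec (tensorPow (LinearMap.toMatrix b b φ) d) c) := by
  have h1 : ∀ x, SymmetricAlgebra.ι ℂ V (φ (b x)) =
      ∑ y, LinearMap.toMatrix b b φ y x • SymmetricAlgebra.ι ℂ V (b y) := by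
    intro x
    conv_lhs => rw [← b.sum_repr (φ (b x)), map_sum]
    refine Finset.sum_congr rfl fun y _ => ?_
    rw [map_smul, LinearMap.toMatrix_apply]
  rw [tensorToSym_apply, tensorToSym_apply, map_sum]
  simp only [map_smul, map_prod, symMap, SymmetricAlgebra.lift_ι_apply, LinearMap.comp_apply, h1]
  simp only [Finset.prod_univ_sum, Finset.smul_sum, Fintype.piFinset_univ]
  rw [Finset.sum_comm]
  refine Finset.sum_congr rfl fun g _ => ?_
  rw [Matrix.mulVec, dotProduct, Finset.sum_smul]
  refine Finset.sum_congr rfl fun f _ => ?_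
  rw [Finset.prod_smul, smul_smul, mul_comm]
  rfl

theorem mem_symInvariants_iff [Fintype B] [DecidableEq B] {K : Type} [Group K]
    (b : Module.Basis B ℂ V) (ρ : Representation ℂ K V) (d : ℕ) (x : SymmetricAlgebra ℂ V) :
    x ∈ symInvariants ρ d ↔ ∃ c, IsSymmTensor c ∧
      (∀ k, Matrix.mulVec (tensorPow (LinearMap.toMatrix b b (ρ k)) d) c = c) ∧
      tensorToSym b d c = x := by
  rw [symInvariants, Submodule.mem_inf, Submodule.mem_iInf]
  simp only [LinearMap.mem_eqLocus, AlgHom.toLinearMap_apply, LinearMap.id_apply]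
  constructor
  · rintro ⟨hx, hK⟩
    obtain ⟨c, hc, rfl⟩ := exists_symmTensor b hx
    refine ⟨c, hc, fun k => ?_, rfl⟩
    rw [← sub_eq_zero]
    refine eq_zero_of_tensorToSym_eq_zero b (fun τ f => ?_) (d := d) ?_
    · rw [Pi.sub_apply, Pi.sub_apply, isSymmTensor_tensorPow_mulVec hc, hc]
    · rw [map_sub, ← symMap_tensorToSym, hK, sub_self]
  · rintro ⟨c, _, hK, rfl⟩
    refine ⟨?_, fun k => ?_⟩
    · rw [← range_tensorToSym b]
      exact ⟨c, rfl⟩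
    · rw [symMap_tensorToSym, hK]

end SymmetricTensors

/-! ### The commutant of block diagonal matrices on tensor powers -/

section BlockDiagonal

theorem tensorPow_mul {m : Type} [Fintype m] (A B : Matrix m m ℂ) (d : ℕ) :
    tensorPow (A * B) d = tensorPow A d * tensorPow B d := by
  ext i j
  simp only [tensorPow, Matrix.mul_apply, Finset.prod_univ_sum, Fintype.piFinset_univ,
    Finset.prod_mul_distrib]

theorem tensorPow_diagonal {m : Type} [DecidableEq m] (v : m → ℂ) (d : ℕ) :
    tensorPow (Matrix.diagonal v) d = Matrix.diagonal fun i => ∏ k, v (i k) := by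
  ext i j
  rw [tensorPow, Matrix.diagonal_apply]
  split_ifs with h
  · rw [h]
    exact Finset.prod_congr rfl fun k _ => Matrix.diagonal_apply_eq v _
  · obtain ⟨k, hk⟩ := Function.ne_iff.1 h
    exact Finset.prod_eq_zero (Finset.mem_univ k) (Matrix.diagonal_apply_ne v hk)

theorem tensorPow_one {m : Type} [DecidableEq m] (d : ℕ) :
    tensorPow (1 : Matrix m m ℂ) d = 1 := by
  rw [← Matrix.diagonal_one, tensorPow_diagonal, ← Matrix.diagonal_one]
  congr 1
  ext i
  exact Finset.prod_const_one

variable {E Q J : Type}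

/-- The matrix `X` is block diagonal with respect to the colouring `col` of its index set. -/
def IsColorBlock (col : J → Q) (X : Matrix J J ℂ) : Prop := ∀ i j, col i ≠ col j → X i j = 0

/-- The operator on the `d`-th tensor power given by a tensor of matrix units with labels `a`. -/
def sliceMatrix {d : ℕ} (c : (Fin d → E × J × J) → ℂ) (a : Fin d → E) :
    Matrix (Fin d → J) (Fin d → J) ℂ := fun i j => c fun k => (a k, i k, j k)

/-- Tensors of labelled matrix units as labels together with two index tuples. -/
def tupleEquiv (E J : Type) (d : ℕ) :
    (Fin d → E × J × J) ≃ (Fin d → E) × (Fin d → J) × (Fin d → J) where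
  toFun f := (fun k => (f k).1, fun k => (f k).2.1, fun k => (f k).2.2)
  invFun p := fun k => (p.1 k, p.2.1 k, p.2.2 k)
  left_inv _ := rfl
  right_inv _ := rfl

theorem sliceMatrix_tensorPow_mulVec [Fintype E] [DecidableEq E] [Fintype J] {d : ℕ}
    (c : (Fin d → E × J × J) → ℂ) (A : Matrix (E × J × J) (E × J × J) ℂ) (g g' : Matrix J J ℂ)
    (hA : ∀ x y, A x y = if x.1 = y.1 then g x.2.1 y.2.1 * g' y.2.2 x.2.2 else 0)
    (a : Fin d → E) : sliceMatrix (Matrix.mulVec (tensorPow A d) c) a =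
      tensorPow g d * sliceMatrix c a * tensorPow g' d := by
  ext i' j'
  rw [sliceMatrix, Matrix.mulVec, dotProduct, ← (tupleEquiv E J d).symm.sum_comp,
    Fintype.sum_prod_type, Finset.sum_eq_single_of_mem a (Finset.mem_univ _),
    Fintype.sum_prod_type_right, Matrix.mul_apply]
  · refine Finset.sum_congr rfl fun j _ => ?_
    rw [Matrix.mul_apply, Finset.sum_mul]
    refine Finset.sum_congr rfl fun i _ => ?_
    simp only [tensorPow, hA, tupleEquiv, Equiv.coe_fn_symm_mk, if_true, Finset.prod_mul_distrib,
      sliceMatrix]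
    ring
  · intro e _ he
    obtain ⟨k, hk⟩ := Function.ne_iff.1 he
    refine Finset.sum_eq_zero fun p _ => ?_
    rw [tensorPow, Finset.prod_eq_zero (Finset.mem_univ k), zero_mul]
    rw [hA]
    exact if_neg fun h => hk h.symm

/-- Commutation with all invertible block diagonal matrices extends to all block diagonal
matrices, by density. -/
theorem commute_tensorPow_of_isUnit [Fintype J] [DecidableEq J] {col : J → Q} {d : ℕ}
    (C : Matrix (Fin d → J) (Fin d → J) ℂ)
    (hC : ∀ g : GL J ℂ, IsColorBlock col (g : Matrix J J ℂ) →
      tensorPow (g : Matrix J J ℂ) d * C = C * tensorPow (g : Matrix J J ℂ) d)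
    (X : Matrix J J ℂ) (hX : IsColorBlock col X) : tensorPow X d * C = C * tensorPow X d := by
  -- The matrix $X+t\cdot1$ is block diagonal, and invertible unless $t$ is one of the finitely many
  -- roots of the characteristic polynomial of $-X$. Continuity then gives the value at $t=0$.
  have hdense : Dense {t : ℂ | (-X).charpoly.IsRoot t}ᶜ :=
    (Polynomial.finite_setOfPred_isRoot
      (Matrix.charpoly_monic (-X)).ne_zero).countable.dense_compl ℂ
  ext i j
  have hcont : ∀ i j, Continuous fun t : ℂ => tensorPow (X + t • (1 : Matrix J J ℂ)) d i j := by
    intro i j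
    simp only [tensorPow, Matrix.add_apply, Matrix.smul_apply]
    fun_prop
  have hL : Continuous fun t : ℂ => (tensorPow (X + t • (1 : Matrix J J ℂ)) d * C) i j := by
    simp only [Matrix.mul_apply]
    exact continuous_finsetSum _ fun l _ => (hcont i l).mul continuous_const
  have hR : Continuous fun t : ℂ => (C * tensorPow (X + t • (1 : Matrix J J ℂ)) d) i j := by
    simp only [Matrix.mul_apply]
    exact continuous_finsetSum _ fun l _ => continuous_const.mul (hcont l j)
  have h := congrFun (Continuous.ext_on hdense hL hR fun t ht => ?_) 0
  · simpa using h
  · have hdet : (X + t • (1 : Matrix J J ℂ)).det ≠ 0 := by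
      intro h0
      refine ht ?_
      change (-X).charpoly.eval t = 0
      rw [Matrix.eval_charpoly, ← h0]
      congr 1
      ext i j
      simp [Matrix.smul_one_eq_diagonal, add_comm]
    refine congrFun (congrFun (hC (Matrix.GeneralLinearGroup.mkOfDetNeZero _ hdet) ?_) i) j
    intro i j hij
    change (X + t • (1 : Matrix J J ℂ)) i j = 0
    have : i ≠ j := fun h => hij (h ▸ rfl)
    simp [hX i j hij, this]

open Classical in
/-- The tensor that connects the indices by labelled permutations with weights `h`. -/
noncomputable def strandTensor (E : Type) {Q J : Type} (col : J → Q) (d : ℕ) :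
    (LabelledPerm (E × Q) (Fin d) → ℂ) →ₗ[ℂ] ((Fin d → E × J × J) → ℂ) where
  toFun h f := ∑ σ : Perm (Fin d), if ∀ k, (f k).2.1 = (f (σ k)).2.2 then
    h ⟨fun k => ((f k).1, col (f k).2.2), σ⟩ else 0
  map_add' h h' := by
    ext f
    simp only [Pi.add_apply, ← Finset.sum_add_distrib]
    refine Finset.sum_congr rfl fun σ _ => ?_
    split_ifs <;> simp
  map_smul' r h := by
    ext f
    simp only [Pi.smul_apply, Finset.smul_sum, RingHom.id_apply]
    refine Finset.sum_congr rfl fun σ _ => ?_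
    split_ifs <;> simp

open Classical in
theorem strandTensor_apply (col : J → Q) {d : ℕ} (h : LabelledPerm (E × Q) (Fin d) → ℂ)
    (f : Fin d → E × J × J) : strandTensor E col d h f =
      ∑ σ : Perm (Fin d), if ∀ k, (f k).2.1 = (f (σ k)).2.2 then
        h ⟨fun k => ((f k).1, col (f k).2.2), σ⟩ else 0 := rfl

theorem strandTensor_comp_perm (col : J → Q) {d : ℕ} (h : LabelledPerm (E × Q) (Fin d) → ℂ)
    (f : Fin d → E × J × J) (τ : Perm (Fin d)) :
    strandTensor E col d h (f ∘ τ) = strandTensor E col d (fun p => h (τ⁻¹ • p)) f := by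
  classical
  rw [strandTensor_apply, strandTensor_apply]
  refine Fintype.sum_equiv ((Equiv.mulLeft τ).trans (Equiv.mulRight τ⁻¹)) _ _ fun σ => ?_
  refine if_congr ?_ ?_ rfl
  · exact ⟨fun h k => by simpa using h (τ.symm k), fun h k => by simpa using h (τ k)⟩
  · rw [LabelledPerm.smul_def]
    congr 1
    refine LabelledPerm.ext rfl ?_
    ext k
    simp [mul_assoc]

/-- Permutations of tensor factors commute with $X^{\otimes d}$. The weights depend on the colours
of the indices, and nonzero entries of a block diagonal $X$ only join indices of equal colour. -/
theorem sliceMatrix_strandTensor_commute [Fintype J] (col : J → Q) {d : ℕ}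
    (h : LabelledPerm (E × Q) (Fin d) → ℂ) (a : Fin d → E) (X : Matrix J J ℂ)
    (hX : IsColorBlock col X) :
    tensorPow X d * sliceMatrix (strandTensor E col d h) a =
      sliceMatrix (strandTensor E col d h) a * tensorPow X d := by
  classical
  ext i j
  rw [Matrix.mul_apply, Matrix.mul_apply]
  simp only [sliceMatrix, strandTensor_apply, Finset.mul_sum, Finset.sum_mul]
  rw [Finset.sum_comm, Finset.sum_comm (s := Finset.univ (α := Fin d → J))]
  refine Finset.sum_congr rfl fun σ _ => ?_
  rw [Finset.sum_eq_single_of_mem (j ∘ σ) (Finset.mem_univ _),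
    Finset.sum_eq_single_of_mem (i ∘ σ.symm) (Finset.mem_univ _)]
  · simp only [Function.comp_apply, Equiv.symm_apply_apply, implies_true, if_true]
    have hprod : tensorPow X d (i ∘ σ.symm) j = tensorPow X d i (j ∘ σ) := by
      rw [tensorPow, tensorPow, ← Equiv.prod_comp σ]
      simp
    rw [hprod, mul_comm]
    by_cases hc : ∀ k, col (i k) = col (j (σ k))
    · congr 3
      ext k
      · rfl
      · have := hc (σ.symm k)
        simpa using this.symm
    · rw [not_forall] at hc
      obtain ⟨k, hk⟩ := hc
      have h0 : tensorPow X d i (j ∘ σ) = 0 :=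
        Finset.prod_eq_zero (Finset.mem_univ k) (hX _ _ hk)
      rw [h0, mul_zero, mul_zero]
  · intro l _ hl
    rw [if_neg, zero_mul]
    intro hl'
    refine hl (funext fun k => ?_)
    have := hl' (σ.symm k)
    simpa using this.symm
  · intro l _ hl
    rw [if_neg, mul_zero]
    exact fun hl' => hl (funext hl')

section Embedding

variable {col : J → Q} {d : ℕ} {em : Q → Fin d → J}

theorem injective_colored_tuple (hcol : ∀ q k, col (em q k) = q)
    (hinj : ∀ q, Function.Injective (em q)) (q : Fin d → Q) :
    Function.Injective fun k => em (q k) k := by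
  intro k k' h
  have hq : q k = q k' := by
    have := congrArg col h
    simpa only [hcol] using this
  refine hinj (q k) ?_
  simpa only [← hq] using h

/-- On a tuple of pairwise distinct indices only one permutation makes the strands match, so each
weight can be read off. The embeddings `em`, which need $d$ distinct indices of every colour, are
where the blocks have to be large. -/
theorem strandTensor_colored (hcol : ∀ q k, col (em q k) = q)
    (hinj : ∀ q, Function.Injective (em q)) (h : LabelledPerm (E × Q) (Fin d) → ℂ)
    (p : LabelledPerm (E × Q) (Fin d)) :
    strandTensor E col d h (fun k => ((p.label k).1, em (p.label (p.perm k)).2 (p.perm k),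
      em (p.label k).2 k)) = h p := by
  classical
  rw [strandTensor_apply, Finset.sum_eq_single_of_mem p.perm (Finset.mem_univ _)]
  · simp only [implies_true, if_true, hcol]
  · intro σ _ hσ
    refine if_neg fun h' => hσ (Equiv.ext fun k => ?_)
    exact (injective_colored_tuple hcol hinj (fun k => (p.label k).2) (h' k)).symm

theorem strandTensor_injective (hcol : ∀ q k, col (em q k) = q)
    (hinj : ∀ q, Function.Injective (em q)) :
    Function.Injective (strandTensor E col d) := by
  intro h h' hh
  funext p
  rw [← strandTensor_colored hcol hinj h p, hh, strandTensor_colored hcol hinj h' p]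

theorem isSymmTensor_strandTensor_iff (hcol : ∀ q k, col (em q k) = q)
    (hinj : ∀ q, Function.Injective (em q)) (h : LabelledPerm (E × Q) (Fin d) → ℂ) :
    IsSymmTensor (strandTensor E col d h) ↔ ∀ (τ : Perm (Fin d)) p, h (τ • p) = h p := by
  constructor
  · intro hs τ p
    have : strandTensor E col d (fun p => h (τ • p)) = strandTensor E col d h := by
      ext f
      rw [← hs τ⁻¹ f, strandTensor_comp_perm, inv_inv]
    exact congrFun (strandTensor_injective hcol hinj this) p
  · intro hs τ f
    have : (fun p => h (τ⁻¹ • p)) = h := funext fun p => hs _ p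
    rw [strandTensor_comp_perm, this]

variable [Fintype J] [DecidableEq J]

/-- If $l$ is not a rearrangement of the distinct indices, it misses one of them. The diagonal
matrix that kills this index is block diagonal for any colouring, and commuting with it gives the
vanishing. -/
theorem eq_zero_of_commute (hcol : ∀ q k, col (em q k) = q)
    (hinj : ∀ q, Function.Injective (em q)) (C : Matrix (Fin d → J) (Fin d → J) ℂ)
    (hC : ∀ X : Matrix J J ℂ, IsColorBlock col X → tensorPow X d * C = C * tensorPow X d)
    (q : Fin d → Q) (l : Fin d → J) (hl : ∀ σ : Perm (Fin d), l ≠ fun k => em (q (σ k)) (σ k)) :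
    C l (fun k => em (q k) k) = 0 := by
  have hj := injective_colored_tuple hcol hinj q
  have hmiss : ∃ k, ∀ k', l k' ≠ em (q k) k := by
    by_contra! hsurj
    choose τ hτ using hsurj
    have hτi : Function.Injective τ := fun k k' h => hj (by simp only [← hτ, h])
    let e := Equiv.ofBijective τ (Finite.injective_iff_bijective.1 hτi)
    refine hl e.symm (funext fun k => ?_)
    have h1 : τ (e.symm k) = k := e.apply_symm_apply k
    rw [← hτ, h1]
  obtain ⟨k, hk⟩ := hmiss
  have h := congrFun (congrFun (hC (Matrix.diagonal fun v => if v = em (q k) k then 0 else 1) ?_) l)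
    (fun k => em (q k) k)
  · have h1 : ∏ k', (if l k' = em (q k) k then (0 : ℂ) else 1) = 1 :=
      Finset.prod_eq_one fun k' _ => if_neg (hk k')
    have h2 : ∏ k', (if em (q k') k' = em (q k) k then (0 : ℂ) else 1) = 0 :=
      Finset.prod_eq_zero (Finset.mem_univ k) (if_pos rfl)
    rwa [tensorPow_diagonal, Matrix.diagonal_mul, Matrix.mul_diagonal, h1, h2, one_mul,
      mul_zero] at h
  · intro i j hij
    exact Matrix.diagonal_apply_ne _ fun h => hij (h ▸ rfl)

/-- A direct substitute for the double centralizer theorem: commutation moves any entry of the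
operator to a column of pairwise distinct indices, where `eq_zero_of_commute` leaves only the
permutations. -/
theorem eq_strandTensor_of_commute (hcol : ∀ q k, col (em q k) = q)
    (hinj : ∀ q, Function.Injective (em q)) (c : (Fin d → E × J × J) → ℂ)
    (hc : ∀ (a : Fin d → E) (X : Matrix J J ℂ), IsColorBlock col X →
      tensorPow X d * sliceMatrix c a = sliceMatrix c a * tensorPow X d) :
    c = strandTensor E col d fun p => sliceMatrix c (fun k => (p.label k).1)
      (fun k => em (p.label (p.perm k)).2 (p.perm k)) (fun k => em (p.label k).2 k) := by
  classical
  funext f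
  set a : Fin d → E := fun k => (f k).1
  set i : Fin d → J := fun k => (f k).2.1
  set j : Fin d → J := fun k => (f k).2.2
  set q : Fin d → Q := fun k => col (j k)
  have hj := injective_colored_tuple hcol hinj q
  -- This $X$ sends the $k$-th distinct index to $j_k$, which has the same colour. Column
  -- $(\mathrm{em}\,q_k\,k)_k$ of $CX^{\otimes d}$ is then column $j$ of $C$.
  let X : Matrix J J ℂ := fun u v => if ∃ k, u = j k ∧ v = em (q k) k then 1 else 0
  have hXb : IsColorBlock col X := by
    intro u v huv
    refine if_neg ?_
    rintro ⟨k, rfl, rfl⟩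
    exact huv (hcol _ _).symm
  have hXv : ∀ u k, X u (em (q k) k) = if u = j k then 1 else 0 := by
    intro u k
    refine if_congr ⟨?_, fun h => ⟨k, h, rfl⟩⟩ rfl rfl
    rintro ⟨k', rfl, hk⟩
    rw [hj hk]
  have h := congrFun (congrFun (hc a X hXb) i) fun k => em (q k) k
  have hr : (sliceMatrix c a * tensorPow X d) i (fun k => em (q k) k) = c f := by
    rw [Matrix.mul_apply, Finset.sum_eq_single_of_mem j (Finset.mem_univ _)]
    · have h1 : tensorPow X d j (fun k => em (q k) k) = 1 :=
        Finset.prod_eq_one fun k _ => by rw [hXv, if_pos rfl]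
      rw [h1, mul_one]
      rfl
    · intro l _ hl
      obtain ⟨k, hk⟩ := Function.ne_iff.1 hl
      rw [tensorPow, Finset.prod_eq_zero (Finset.mem_univ k), mul_zero]
      rw [hXv, if_neg hk]
  rw [← hr, ← h, Matrix.mul_apply, strandTensor_apply]
  symm
  refine Finset.sum_of_injOn (fun σ : Perm (Fin d) => fun k => em (q (σ k)) (σ k)) ?_ ?_ ?_ ?_
  · intro σ _ σ' _ hσ
    exact Equiv.ext fun k => hj (congrFun hσ k)
  · intro _ _
    exact Finset.mem_coe.2 (Finset.mem_univ _)
  · intro l _ hl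
    rw [eq_zero_of_commute hcol hinj _ (hc a) q l, mul_zero]
    rintro σ rfl
    exact hl ⟨σ, Finset.mem_coe.2 (Finset.mem_univ _), rfl⟩
  · intro σ _
    have h2 : tensorPow X d i (fun k => em (q (σ k)) (σ k)) =
        if ∀ k, i k = j (σ k) then 1 else 0 := by
      rw [tensorPow]
      simp only [hXv]
      rw [Finset.prod_ite_zero]
      simp
    rw [h2, ite_mul, one_mul, zero_mul]
    by_cases hP : ∀ k, i k = j (σ k)
    · rw [if_pos hP]
      exact (if_pos hP).symm
    · rw [if_neg hP]
      exact (if_neg hP).symm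

end Embedding

variable {V K : Type} [AddCommGroup V] [Module ℂ V] [Group K] [Fintype E] [DecidableEq E]
  [Fintype J] [DecidableEq J]

/-- The action of `g` by conjugation on labelled matrix units. -/
def ActsByConj (b : Module.Basis (E × J × J) ℂ V) (φ : V →ₗ[ℂ] V) (g : GL J ℂ) : Prop :=
  ∀ e i j, φ (b (e, i, j)) = ∑ i', ∑ j', ((g : Matrix J J ℂ) i' i *
    ((g⁻¹ : GL J ℂ) : Matrix J J ℂ) j j') • b (e, i', j')

theorem ActsByConj.toMatrix {b : Module.Basis (E × J × J) ℂ V} {φ : V →ₗ[ℂ] V} {g : GL J ℂ}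
    (h : ActsByConj b φ g) (x y : E × J × J) : LinearMap.toMatrix b b φ x y =
      if x.1 = y.1 then (g : Matrix J J ℂ) x.2.1 y.2.1 *
        ((g⁻¹ : GL J ℂ) : Matrix J J ℂ) y.2.2 x.2.2 else 0 := by
  obtain ⟨e, i, j⟩ := y
  obtain ⟨e', i', j'⟩ := x
  rw [LinearMap.toMatrix_apply, h e i j]
  simp only [map_sum, map_smul, Module.Basis.repr_self, Finsupp.finsetSum_apply,
    Finsupp.smul_apply, smul_eq_mul]
  split_ifs with he
  · obtain rfl : e' = e := he
    rw [Finset.sum_eq_single_of_mem i' (Finset.mem_univ _),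
      Finset.sum_eq_single_of_mem j' (Finset.mem_univ _)]
    · simp
    · intro j'' _ hne
      simp [hne]
    · intro i'' _ hne
      refine Finset.sum_eq_zero fun j'' _ => ?_
      simp [hne]
  · refine Finset.sum_eq_zero fun i'' _ => Finset.sum_eq_zero fun j'' _ => ?_
    rw [Finsupp.single_apply, if_neg, mul_zero]
    exact fun h' => he (Prod.ext_iff.1 h').1.symm

theorem ActsByConj.tensorPow_mulVec_eq_iff {b : Module.Basis (E × J × J) ℂ V} {φ : V →ₗ[ℂ] V}
    {g : GL J ℂ} (h : ActsByConj b φ g) {d : ℕ} (c : (Fin d → E × J × J) → ℂ) :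
    Matrix.mulVec (tensorPow (LinearMap.toMatrix b b φ) d) c = c ↔
      ∀ a, tensorPow (g : Matrix J J ℂ) d * sliceMatrix c a =
        sliceMatrix c a * tensorPow (g : Matrix J J ℂ) d := by
  have hslice := fun a => sliceMatrix_tensorPow_mulVec c _ _ _ h.toMatrix a
  have h1 : tensorPow (g : Matrix J J ℂ) d * tensorPow ((g⁻¹ : GL J ℂ) : Matrix J J ℂ) d = 1 := by
    rw [← tensorPow_mul, ← Units.val_mul, mul_inv_cancel, Units.val_one, tensorPow_one]
  have h2 : tensorPow ((g⁻¹ : GL J ℂ) : Matrix J J ℂ) d * tensorPow (g : Matrix J J ℂ) d = 1 := by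
    rw [← tensorPow_mul, ← Units.val_mul, inv_mul_cancel, Units.val_one, tensorPow_one]
  constructor
  · intro hc a
    have := hslice a
    rw [hc] at this
    conv_rhs => rw [this, Matrix.mul_assoc, h2, Matrix.mul_one]
  · intro hc
    funext f
    have := congrFun (congrFun (hslice fun k => (f k).1) fun k => (f k).2.1) fun k => (f k).2.2
    rw [hc, Matrix.mul_assoc, h1, Matrix.mul_one] at this
    exact this

/-- The invariants of a block diagonal group on labelled matrices have the labelled permutations
up to conjugation as a basis, in degrees up to the size of the blocks. -/
theorem finrank_symInvariants_eq_card_orbits (b : Module.Basis (E × J × J) ℂ V)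
    (ρ : Representation ℂ K V) (col : J → Q) [Finite Q]
    (hρ : ∀ k, ∃ g : GL J ℂ, IsColorBlock col (g : Matrix J J ℂ) ∧ ActsByConj b (ρ k) g)
    (hg : ∀ g : GL J ℂ, IsColorBlock col (g : Matrix J J ℂ) → ∃ k, ActsByConj b (ρ k) g)
    (d : ℕ) (em : Q → Fin d → J) (hcol : ∀ q k, col (em q k) = q)
    (hinj : ∀ q, Function.Injective (em q)) :
    Module.finrank ℂ (symInvariants ρ d) =
      Nat.card (MulAction.orbitRel.Quotient (Perm (Fin d)) (LabelledPerm (E × Q) (Fin d))) := by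
  let O := MulAction.orbitRel.Quotient (Perm (Fin d)) (LabelledPerm (E × Q) (Fin d))
  -- Functions on orbits are the weights invariant under conjugation, which by
  -- `isSymmTensor_strandTensor_iff` are the ones that give symmetric tensors.
  let pull : (O → ℂ) →ₗ[ℂ] (LabelledPerm (E × Q) (Fin d) → ℂ) :=
    LinearMap.funLeft ℂ ℂ fun p => (Quotient.mk _ p : O)
  have hpull : ∀ u (τ : Perm (Fin d)) p, pull u (τ • p) = pull u p := by
    intro u τ p
    exact congrArg u (Quotient.sound ⟨τ, rfl⟩)
  let Φ : (O → ℂ) →ₗ[ℂ] SymmetricAlgebra ℂ V := tensorToSym b d ∘ₗ strandTensor E col d ∘ₗ pull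
  have hΦ : Function.Injective Φ := by
    rw [injective_iff_map_eq_zero]
    intro u hu
    have h1 := eq_zero_of_tensorToSym_eq_zero b
      ((isSymmTensor_strandTensor_iff hcol hinj _).2 (hpull u)) hu
    have h2 := strandTensor_injective hcol hinj (h1.trans (map_zero _).symm)
    funext o
    obtain ⟨p, rfl⟩ := Quotient.exists_rep o
    exact congrFun h2 p
  have hrange : LinearMap.range Φ = symInvariants ρ d := by
    ext x
    rw [mem_symInvariants_iff b]
    constructor
    · rintro ⟨u, rfl⟩
      refine ⟨_, (isSymmTensor_strandTensor_iff hcol hinj _).2 (hpull u), fun k => ?_, rfl⟩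
      obtain ⟨g, hgb, hgk⟩ := hρ k
      rw [hgk.tensorPow_mulVec_eq_iff]
      exact fun a => sliceMatrix_strandTensor_commute col _ a _ hgb
    · rintro ⟨c, hc, hck, rfl⟩
      have hcomm : ∀ (a : Fin d → E) (X : Matrix J J ℂ), IsColorBlock col X →
          tensorPow X d * sliceMatrix c a = sliceMatrix c a * tensorPow X d := by
        refine fun a => commute_tensorPow_of_isUnit _ fun g hgb => ?_
        obtain ⟨k, hk⟩ := hg g hgb
        exact (hk.tensorPow_mulVec_eq_iff c).1 (hck k) a
      have hs := eq_strandTensor_of_commute hcol hinj c hcomm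
      rw [hs, isSymmTensor_strandTensor_iff hcol hinj] at hc
      refine ⟨fun o => Quotient.liftOn o (fun p => sliceMatrix c (fun k => (p.label k).1)
          (fun k => em (p.label (p.perm k)).2 (p.perm k)) (fun k => em (p.label k).2 k)) ?_, ?_⟩
      · rintro p p' ⟨τ, rfl⟩
        exact hc τ p'
      · conv_rhs => rw [hs]
        rfl
  have : Fintype O := Fintype.ofFinite O
  rw [← hrange, LinearMap.finrank_range_of_inj hΦ, Module.finrank_fintype_fun_eq_card,
    Nat.card_eq_fintype_card]

end BlockDiagonal

end Invariants

/-! ### The two families of representations and the stable limits -/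

section Representations

theorem adjointRep_single {ι : Type} [Fintype ι] [DecidableEq ι] (g : GL ι ℂ) (i j : ι) :
    adjointRep ι g (Matrix.single i j 1) = ∑ i', ∑ j', ((g : Matrix ι ι ℂ) i' i *
      ((g⁻¹ : GL ι ℂ) : Matrix ι ι ℂ) j j') • Matrix.single i' j' (1 : ℂ) := by
  change (g : Matrix ι ι ℂ) * Matrix.single i j 1 * ((g⁻¹ : GL ι ℂ) : Matrix ι ι ℂ) = _
  conv_lhs => rw [Matrix.matrix_eq_sum_single ((g : Matrix ι ι ℂ) * Matrix.single i j 1 *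
    ((g⁻¹ : GL ι ℂ) : Matrix ι ι ℂ))]
  refine Finset.sum_congr rfl fun i' _ => Finset.sum_congr rfl fun j' _ => ?_
  rw [Matrix.smul_single, smul_eq_mul, mul_one, Matrix.mul_apply,
    Finset.sum_eq_single_of_mem j (Finset.mem_univ _)]
  · rw [Matrix.mul_single_apply_same, mul_one]
  · intro k _ hk
    rw [Matrix.mul_single_apply_of_ne _ _ _ _ _ hk, zero_mul]

/-- The matrix units of two copies of the square matrices. -/
noncomputable def pairBasis (n : ℕ) : Module.Basis (Bool × Fin n × Fin n) ℂ
    (Matrix (Fin n) (Fin n) ℂ × Matrix (Fin n) (Fin n) ℂ) :=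
  ((Matrix.stdBasis ℂ (Fin n) (Fin n)).prod (Matrix.stdBasis ℂ (Fin n) (Fin n))).reindex
    (Equiv.boolProdEquivSum _).symm

theorem pairBasis_false (n : ℕ) (i j : Fin n) :
    pairBasis n (false, i, j) = (Matrix.single i j 1, 0) := by
  rw [pairBasis, Module.Basis.reindex_apply]
  simp [Equiv.boolProdEquivSum, Matrix.stdBasis_eq_single]

theorem pairBasis_true (n : ℕ) (i j : Fin n) :
    pairBasis n (true, i, j) = (0, Matrix.single i j 1) := by
  rw [pairBasis, Module.Basis.reindex_apply]
  simp [Equiv.boolProdEquivSum, Matrix.stdBasis_eq_single]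

theorem actsByConj_glnRep (n : ℕ) (g : GL (Fin n) ℂ) :
    ActsByConj (pairBasis n) (glnRep n g) g := by
  rintro (_ | _) i j
  · simp only [pairBasis_false]
    change (adjointRep (Fin n) g (Matrix.single i j 1), adjointRep (Fin n) g 0) = _
    rw [adjointRep_single, map_zero]
    ext1 <;> simp [Prod.fst_sum, Prod.snd_sum]
  · simp only [pairBasis_true]
    change (adjointRep (Fin n) g 0, adjointRep (Fin n) g (Matrix.single i j 1)) = _
    rw [adjointRep_single, map_zero]
    ext1 <;> simp [Prod.fst_sum, Prod.snd_sum]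

theorem card_orbits_eq_coeff_stableProduct (L : Type) [Finite L] (hL : Nat.card L = 2) (d : ℕ) :
    (Nat.card (MulAction.orbitRel.Quotient (Equiv.Perm (Fin d)) (LabelledPerm L (Fin d))) : ℚ) =
      PowerSeries.coeff d stableProduct := by
  rw [card_orbits_labelledPerm, coeff_stableProduct, hL, Fintype.card_fin]
  push_cast
  rfl

/-- One colour and two copies of the matrices: the two labels come from `Bool` in the basis. -/
theorem coeff_hilbertSeries_glnRep {n d : ℕ} (h : d ≤ n) :
    PowerSeries.coeff d (hilbertSeries (glnRep n)) = PowerSeries.coeff d stableProduct := by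
  rw [hilbertSeries, PowerSeries.coeff_mk, finrank_symInvariants_eq_card_orbits (pairBasis n)
    (glnRep n) (fun _ => ()) (fun g => ⟨g, fun _ _ h => absurd rfl h, actsByConj_glnRep n g⟩)
    (fun g _ => ⟨g, actsByConj_glnRep n g⟩) d (fun _ => Fin.castLE h) (fun _ _ => rfl)
    fun _ => Fin.castLE_injective h]
  exact card_orbits_eq_coeff_stableProduct _ (by simp) d

/-- The matrix units, with a trivial label. -/
noncomputable def unitBasis (J : Type) [Fintype J] [DecidableEq J] :
    Module.Basis (Unit × J × J) ℂ (Matrix J J ℂ) :=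
  (Matrix.stdBasis ℂ J J).reindex (Equiv.punitProd _).symm

theorem unitBasis_apply (J : Type) [Fintype J] [DecidableEq J] (e : Unit) (i j : J) :
    unitBasis J (e, i, j) = Matrix.single i j 1 := by
  rw [unitBasis, Module.Basis.reindex_apply]
  exact Matrix.stdBasis_eq_single ℂ i j

theorem actsByConj_adjointRep (J : Type) [Fintype J] [DecidableEq J] (g : GL J ℂ) :
    ActsByConj (unitBasis J) (adjointRep J g) g := by
  intro e i j
  simp only [unitBasis_apply]
  exact adjointRep_single g i j

theorem isColorBlock_blockDiagonalHom {p q : ℕ} (k : GL (Fin p) ℂ × GL (Fin q) ℂ) :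
    IsColorBlock Sum.isLeft
      (blockDiagonalHom p q k : Matrix (Fin p ⊕ Fin q) (Fin p ⊕ Fin q) ℂ) := by
  rintro (i | i) (j | j) h
  · exact absurd rfl h
  · rfl
  · rfl
  · exact absurd rfl h

theorem exists_blockDiagonalHom_eq {p q : ℕ} (g : GL (Fin p ⊕ Fin q) ℂ)
    (hg : IsColorBlock Sum.isLeft (g : Matrix (Fin p ⊕ Fin q) (Fin p ⊕ Fin q) ℂ)) :
    ∃ k, blockDiagonalHom p q k = g := by
  set M := (g : Matrix (Fin p ⊕ Fin q) (Fin p ⊕ Fin q) ℂ) with hM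
  have hblocks : M = Matrix.fromBlocks M.toBlocks₁₁ 0 0 M.toBlocks₂₂ := by
    ext (i | i) (j | j)
    · rfl
    · exact hg _ _ (by simp)
    · exact hg _ _ (by simp)
    · rfl
  have hdet : M.det ≠ 0 := Matrix.GeneralLinearGroup.det_ne_zero g
  rw [hblocks, Matrix.det_fromBlocks_zero₂₁] at hdet
  refine ⟨(Matrix.GeneralLinearGroup.mkOfDetNeZero _ (left_ne_zero_of_mul hdet),
    Matrix.GeneralLinearGroup.mkOfDetNeZero _ (right_ne_zero_of_mul hdet)), Units.ext ?_⟩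
  exact hblocks.symm

/-- One copy of the matrices and two colours, the blocks: the two labels now come from `Sum.isLeft`.
The bound $d\le\min(p,q)$ gives $d$ distinct indices in each block. -/
theorem coeff_hilbertSeries_upqRep {p q d : ℕ} (h : d ≤ min p q) :
    PowerSeries.coeff d (hilbertSeries (upqRep p q)) = PowerSeries.coeff d stableProduct := by
  rw [hilbertSeries, PowerSeries.coeff_mk, finrank_symInvariants_eq_card_orbits (unitBasis _)
    (upqRep p q) Sum.isLeft
    (fun k => ⟨_, isColorBlock_blockDiagonalHom k, actsByConj_adjointRep _ _⟩) ?_ d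
    (fun c k => if c then Sum.inl (Fin.castLE (h.trans (min_le_left p q)) k)
      else Sum.inr (Fin.castLE (h.trans (min_le_right p q)) k)) ?_ ?_]
  · exact card_orbits_eq_coeff_stableProduct _ (by simp) d
  · intro g hg
    obtain ⟨k, rfl⟩ := exists_blockDiagonalHom_eq g hg
    exact ⟨k, actsByConj_adjointRep _ _⟩
  · rintro (_ | _) k <;> rfl
  · rintro (_ | _) k k' hk
    · exact Fin.castLE_injective _ (Sum.inr_injective hk)
    · exact Fin.castLE_injective _ (Sum.inl_injective hk)

theorem tendsto_of_coeff_eventually_eq {ι : Type*} {l : Filter ι} {f : ι → PowerSeries ℚ}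
    {g : PowerSeries ℚ} (h : ∀ d, ∀ᶠ i in l, PowerSeries.coeff d (f i) = PowerSeries.coeff d g) :
    Tendsto f l (𝓝 g) := by
  rw [PowerSeries.WithPiTopology.tendsto_iff_coeff_tendsto]
  exact fun d => tendsto_const_nhds.congr' ((h d).mono fun _ hi => hi.symm)

end Representations

theorem mainTheorem3 :
    (∀ μ ν : YoungDiagram, ∃! f : YoungDiagram →₀ ℤ, IsSchurExpansion μ ν f) ∧
    Multipliable (fun k : ℕ => (1 - 2 * (PowerSeries.X : PowerSeries ℚ) ^ (k + 1))⁻¹) ∧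
    HasSum (fun τ : YoungDiagram × YoungDiagram × YoungDiagram =>
        PowerSeries.C ((lrCoeff τ.1 τ.2.1 τ.2.2 : ℚ) ^ 2) * PowerSeries.X ^ τ.1.card)
      stableProduct ∧
    Tendsto (fun pq : ℕ × ℕ => hilbertSeries (upqRep pq.1 pq.2))
      (comap (fun pq : ℕ × ℕ => min pq.1 pq.2) atTop) (𝓝 stableProduct) ∧
    Tendsto (fun n : ℕ => hilbertSeries (glnRep n)) atTop (𝓝 stableProduct) := by
  refine ⟨existsUnique_isSchurExpansion, hasProd_stable.multipliable, hasSum_sq_lrCoeff, ?_, ?_⟩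
  · exact tendsto_of_coeff_eventually_eq fun d =>
      ((eventually_ge_atTop d).comap _).mono fun _ h => coeff_hilbertSeries_upqRep h
  · exact tendsto_of_coeff_eventually_eq fun d =>
      (eventually_ge_atTop d).mono fun _ h => coeff_hilbertSeries_glnRep h
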